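/- Let $\mathcal D_0,\mathcal D_1,\dots$ be $k$ probability distributions ($1\le k\le\infty$) on pairs $(x,y)\in\mathbb R^d\times\mathbb R$, and let $C_1,C_2>0$ be such that, for every component $i$, the second-moment matrix $\Sigma_i=\mathbb E_{\mathcal D_i}[xx^\top]$ satisfies $\|\Sigma_i\|\le C_1$ (spectral norm) and $\|x\|\le C_2\sqrt d$ holds $\mathcal D_i$-almost surely. For $w\in\mathbb R^d$ and $\kappa>0$, the clipped gradient is $$\nabla f(x,y,w,\kappa)=\frac{x\cdot w-y}{\max(|x\cdot w-y|,\kappa)}\,\kappa x,\qquad \nabla f(S,w,\kappa)=\frac1{|S|}\sum_{(x,y)\in S}\nabla f(x,y,w,\kappa)$$ for a finite collection $S$ of samples. Let $\widehat B$ be a collection of $|\widehat B|$ independent batches; each batch $b$ consists of at least two i.i.d. samples from one of the distributions $\mathcal D_i$. Let $p_0$ be the fraction of batches in $\widehat B$ that are sampled from $\mathcal D_0$. The subroutine $\textsc{GradSubEst}(\widehat B,\kappa,w,\ell)$ divides the samples of each batch $b\in\widehat B$ uniformly at random (independently over batches and of the samples) into two equal parts $S_1^b,S_2^b$ (of sizes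 $\lfloor n/2\rfloor$ and $\lceil n/2\rceil$ if $b$ has $n$ samples), forms $$A=\frac1{2|\widehat B|}\sum_{b\in\widehat B}\Big(\nabla f(S_1^b,w,\kappa)\nabla f(S_2^b,w,\kappa)^\top+\nabla f(S_2^b,w,\kappa)\nabla f(S_1^b,w,\kappa)^\top\Big),$$ and returns $UU^\top$, where the columns of $U$ are (orthonormal) top $\ell$ singular vectors of $A$ (all $d$ of them if $\ell>d$; ties are broken arbitrarily). **Theorem.** There is an absolute constant $K>0$ such that the following holds for all $d$, $k$, $\mathcal D_i$, $C_1$, $C_2$ as above, all $w\in\mathbb R^d$ and $\kappa>0$, and all $\alpha_s,\epsilon,\delta'>0$. If $$|\widehat B|\ \ge\ K\,\frac{d}{\alpha_s\epsilon^2}\left(\frac1{\alpha_s\epsilon^2}+\frac{C_2^2}{C_1}\right)\log\frac d{\delta'},\qquad p_0\ge\frac{\alpha_s}2,\qquad \ell\ge\min\Big\{k,\frac1{2\alpha_s\epsilon^2}\Big\},$$ then with probability at least $1-\delta'$, every matrix $UU^\top$ that $\textsc{GradSubEst}(\widehat B,\kappa,w,\ell)$ may return satisfies $$\big\|(I-UU^\top)\,\mathbb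 E_{\mathcal D_0}[\nabla f(x,y,w,\kappa)]\big\|\ \le\ 4\,\epsilon\,\kappa\,\sqrt{C_1}.$$ -/

import Mathlib

open MeasureTheory
open scoped ENNReal

noncomputable section

namespace GradSub

/-- A labelled sample `(x, y)` with `x ∈ ℝ^d` (Euclidean norm) and `y ∈ ℝ`. -/
abbrev Sample (d : ℕ) : Type := EuclideanSpace ℝ (Fin d) × ℝ

/-- The clipped gradient `∇f(x, y, w, κ) = (x·w - y) / max(|x·w - y|, κ) * κ x` of the squared loss. -/
def clippedGrad {d : ℕ} (w : EuclideanSpace ℝ (Fin d)) (κ : ℝ) (p : Sample d) :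
    EuclideanSpace ℝ (Fin d) :=
  ((inner ℝ p.1 w - p.2) / max |inner ℝ p.1 w - p.2| κ * κ) • p.1

/-- The clipped gradient of the collection of those samples of `S` whose index lies in `T`:
the average of the clipped gradients of its members. -/
def clippedGradAvg {d n : ℕ} (w : EuclideanSpace ℝ (Fin d)) (κ : ℝ)
    (S : Fin n → Sample d) (T : Finset (Fin n)) : EuclideanSpace ℝ (Fin d) :=
  (T.card : ℝ)⁻¹ • ∑ j ∈ T, clippedGrad w κ (S j)

/-- The second-moment matrix `Σ = E[x xᵀ]` of the input under `D`. -/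
def secondMoment {d : ℕ} (D : Measure (Sample d)) : Matrix (Fin d) (Fin d) ℝ :=
  Matrix.of fun i j => ∫ p, p.1 i * p.1 j ∂D

/-- The spectral norm of a matrix: the operator norm for the Euclidean norm. -/
def spectralNorm {d : ℕ} (M : Matrix (Fin d) (Fin d) ℝ) : ℝ :=
  ‖Matrix.toEuclideanCLM (n := Fin d) (𝕜 := ℝ) M‖

/-- The ways to divide `n` samples into two equal parts, given by the index set of the first part;
the second part is the complement (for odd `n` it has one sample more). -/
def Split (n : ℕ) : Type := {T : Finset (Fin n) // T.card = n / 2}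

instance (n : ℕ) : Fintype (Split n) := by
  unfold Split; infer_instance

instance (n : ℕ) : Nonempty (Split n) := by
  obtain ⟨T, _, hT⟩ := Finset.exists_subset_card_eq (s := (Finset.univ : Finset (Fin n)))
    (n := n / 2) (by simpa using Nat.div_le_self n 2)
  exact ⟨⟨T, hT⟩⟩

instance (n : ℕ) : MeasurableSpace (Split n) := ⊤

instance (n : ℕ) : MeasurableSingletonClass (Split n) := ⟨fun _ => trivial⟩

/-- Indices of the first part. -/
def Split.fst {n : ℕ} (T : Split n) : Finset (Fin n) := T.1

/-- Indices of the second part. -/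
def Split.snd {n : ℕ} (T : Split n) : Finset (Fin n) := (T.1)ᶜ

/-- A batch of `n` samples together with the division chosen for it. -/
abbrev SplitBatch (d n : ℕ) : Type := (Fin n → Sample d) × Split n

/-- The law of a batch of `n` i.i.d. samples from `D`, together with a uniformly random division
of it into two equal parts, chosen independently of the samples. -/
def batchLaw {d : ℕ} (n : ℕ) (D : Measure (Sample d)) : Measure (SplitBatch d n) :=
  (Measure.pi fun _ : Fin n => D).prod (PMF.uniformOfFintype (Split n)).toMeasure

instance {d n : ℕ} (D : Measure (Sample d)) [IsProbabilityMeasure D] :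
    IsProbabilityMeasure (batchLaw n D) := by
  unfold batchLaw; infer_instance

/-- The joint law of `N` independent batches (with their divisions), the batch `b` consisting of
`n b` i.i.d. samples from `D (c b)`. -/
def batchesLaw {d N : ℕ} (D : ℕ → Measure (Sample d)) (c : Fin N → ℕ) (n : Fin N → ℕ) :
    Measure (∀ b, SplitBatch d (n b)) :=
  Measure.pi fun b => batchLaw (n b) (D (c b))

instance {d N : ℕ} (D : ℕ → Measure (Sample d)) [∀ i, IsProbabilityMeasure (D i)]
    (c : Fin N → ℕ) (n : Fin N → ℕ) : IsProbabilityMeasure (batchesLaw D c n) := by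
  unfold batchesLaw; infer_instance

/-- The fraction `p_i` of the batches that are sampled from the component `i`. -/
def fraction {N : ℕ} (c : Fin N → ℕ) (i : ℕ) : ℝ :=
  ((Finset.univ.filter fun b => c b = i).card : ℝ) / N

/-- The matrix `A = 1/(2N) ∑_b (u_b v_bᵀ + v_b u_bᵀ)`, where `u_b` and `v_b` are the clipped
gradients of the two parts of the batch `b`. -/
def gradMatrix {d N : ℕ} {n : Fin N → ℕ} (w : EuclideanSpace ℝ (Fin d)) (κ : ℝ)
    (B : ∀ b, SplitBatch d (n b)) : Matrix (Fin d) (Fin d) ℝ :=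
  (1 / (2 * (N : ℝ))) • ∑ b,
    (Matrix.vecMulVec (clippedGradAvg w κ (B b).1 (B b).2.fst).ofLp
        (clippedGradAvg w κ (B b).1 (B b).2.snd).ofLp
      + Matrix.vecMulVec (clippedGradAvg w κ (B b).1 (B b).2.snd).ofLp
        (clippedGradAvg w κ (B b).1 (B b).2.fst).ofLp)

/-- `A = ∑_i σ_i u_i v_iᵀ` is a singular value decomposition, `σ_1 ≥ σ_2 ≥ … ≥ σ_d ≥ 0`. -/
structure IsSVD {d : ℕ} (A : Matrix (Fin d) (Fin d) ℝ) (σ : Fin d → ℝ)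
    (u v : OrthonormalBasis (Fin d) ℝ (EuclideanSpace ℝ (Fin d))) : Prop where
  antitone : Antitone σ
  nonneg : ∀ i, 0 ≤ σ i
  eq_sum : A = ∑ i, σ i • Matrix.vecMulVec (u i).ofLp (v i).ofLp

/-- The columns of `U` are top `ℓ` singular vectors of `A`: the first `ℓ` left singular vectors in
some singular value decomposition of `A` (all `d` of them if `ℓ > d`). For a symmetric matrix such
as `gradMatrix`, left and right singular vectors are the same notion, by transposition. -/
def IsTopSingularVectors {d : ℕ} (A : Matrix (Fin d) (Fin d) ℝ) (ℓ : ℕ)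
    (U : Matrix (Fin d) (Fin (min ℓ d)) ℝ) : Prop :=
  ∃ (σ : Fin d → ℝ) (u v : OrthonormalBasis (Fin d) ℝ (EuclideanSpace ℝ (Fin d))),
    IsSVD A σ u v ∧ ∀ i j, U i j = u (Fin.castLE (min_le_right ℓ d) j) i

/-- `P` is a possible output of the subspace estimation subroutine on the divided batches `B`:
`P = U Uᵀ` for some choice of top `ℓ` singular vectors of `A`. -/
def IsGradSubEst {d N : ℕ} {n : Fin N → ℕ} (B : ∀ b, SplitBatch d (n b)) (κ : ℝ)
    (w : EuclideanSpace ℝ (Fin d)) (ℓ : ℕ) (P : Matrix (Fin d) (Fin d) ℝ) : Prop :=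
  ∃ U : Matrix (Fin d) (Fin (min ℓ d)) ℝ,
    IsTopSingularVectors (gradMatrix w κ B) ℓ U ∧ P = U * U.transpose

end GradSub

end

/-! ### Trace inequalities for powers of products of real matrices. -/

namespace Matrix

/-! Write `g i` for the mean clipped gradient of component `i`, `s = κ² C₁`, and `M` for the average
of `g (c b) (g (c b))ᵀ` over the batches. The two parts of a batch share no sample, so their clipped
gradients are independent with the same mean, and `A` has expectation exactly `M`. Clipping bounds
the scalar factor by `κ`, so a clipped gradient has second moment at most `s` in every direction and
norm at most `κ C₂ √d`. Hence each summand `X` of `A` has norm at most `κ² C₂² d` almost surely and,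
again by independence, `E ‖X x‖² ≤ d s² ‖x‖²`. A matrix Bernstein inequality
(`measureReal_le_norm_sum_le`) then gives `‖A - M‖ ≤ α ε² s` with probability at least `1 - δ`.

The rest is deterministic (`norm_sq_residual_le`). The residual `z = (I - UUᵀ) g 0` is orthogonal to
the top `ℓ` singular vectors, so `zᵀAz` is at most `‖z‖²` times the next singular value `σ`. On the
other hand `⟨z, g 0⟩ = ‖z‖²`, so `zᵀMz ≥ p₀ ‖z‖⁴`. Thus `p₀ ‖z‖² ≤ σ + ‖A - M‖`. If `k ≤ ℓ`, then
`M` has rank at most `ℓ` and Weyl's inequality gives `σ ≤ ‖A - M‖`. Otherwise Jensen gives `‖g i‖² ≤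
s`, so `M` has trace at most `s`, and averaging over the first `ℓ + 1` singular values gives `σ ≤ ‖A
- M‖ + s / (ℓ + 1)`. Either way the total is at most `4 α ε² s`, and `p₀ ≥ α / 2` yields `‖z‖² ≤ 8
ε² s`.

Bernstein is obtained by the Ahlswede-Winter method: the expected trace of the exponential of an
independent sum is peeled off one summand at a time by the Golden-Thompson inequality, which follows
from a trace inequality for powers of two and the Lie-Trotter formula. -/

theorem two_mul_trace_mul_le {m : Type*} [Fintype m] (X Y : Matrix m m ℝ) :
    2 * (X * Y).trace ≤ (X * Xᵀ).trace + (Y * Yᵀ).trace := by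
  have h : (Y * Yᵀ).trace = (Yᵀ * Y).trace := trace_mul_comm _ _
  rw [h]
  simp only [trace, diag_apply, mul_apply, transpose_apply, Finset.mul_sum,
    ← Finset.sum_add_distrib]
  refine Finset.sum_le_sum fun i _ => Finset.sum_le_sum fun j _ => ?_
  nlinarith [sq_nonneg (X i j - Y j i)]

variable {m : Type*} [Fintype m] [DecidableEq m]

theorem mul_pow_mul_comm (A B : Matrix m m ℝ) (k : ℕ) :
    A * (B * A) ^ k = (A * B) ^ k * A := by
  induction k with
  | zero => simp
  | succ k ih => rw [pow_succ, ← mul_assoc, ih, pow_succ]; simp only [mul_assoc]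

theorem trace_mul_pow_comm (A B : Matrix m m ℝ) (k : ℕ) :
    ((A * B) ^ k).trace = ((B * A) ^ k).trace := by
  cases k with
  | zero => simp
  | succ k =>
    rw [pow_succ, ← mul_assoc, ← mul_pow_mul_comm, mul_assoc, trace_mul_comm, mul_assoc, ← pow_succ]

/-- The two claims feed each other, hence the joint induction. The first, at `M * M`, turns by
cyclicity into a trace of powers of `(Mᵀ * M) * (M * Mᵀ)`, which the second splits and
Cauchy-Schwarz finishes. The second follows from the first at `P * Q`, since cyclicity turns `P Q Q
P` into `P² Q²`. -/
theorem trace_pow_le_and_trace_mul_pow_le (j : ℕ) :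
    (∀ M : Matrix m m ℝ, (M ^ (2 * 2 ^ j)).trace ≤ ((M * Mᵀ) ^ 2 ^ j).trace) ∧
    ∀ P Q : Matrix m m ℝ, P.IsSymm → Q.IsSymm →
      ((P * Q) ^ 2 ^ j).trace ≤ (P ^ 2 ^ j * Q ^ 2 ^ j).trace := by
  induction j with
  | zero =>
    refine ⟨fun M => ?_, fun P Q _ _ => by simp⟩
    have h := two_mul_trace_mul_le M M
    simp only [pow_zero, mul_one, pow_one, pow_two]
    linarith
  | succ j ih =>
    obtain ⟨hC, hG⟩ := ih
    refine ⟨fun M => ?_, fun P Q hP hQ => ?_⟩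
    · have hP : (Mᵀ * M).IsSymm := by simp [IsSymm, transpose_mul]
      have hQ : (M * Mᵀ).IsSymm := by simp [IsSymm, transpose_mul]
      calc (M ^ (2 * 2 ^ (j + 1))).trace = ((M * M) ^ (2 * 2 ^ j)).trace := by
            rw [← pow_two, ← pow_mul]; congr 2; ring
        _ ≤ ((M * M * (M * M)ᵀ) ^ 2 ^ j).trace := hC _
        _ = ((Mᵀ * M * (M * Mᵀ)) ^ 2 ^ j).trace := by
            rw [transpose_mul, show M * M * (Mᵀ * Mᵀ) = M * (M * Mᵀ * Mᵀ) by
              simp only [mul_assoc], trace_mul_pow_comm, trace_mul_pow_comm (Mᵀ * M)]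
            simp only [mul_assoc]
        _ ≤ ((Mᵀ * M) ^ 2 ^ j * (M * Mᵀ) ^ 2 ^ j).trace := hG _ _ hP hQ
        _ ≤ ((M * Mᵀ) ^ 2 ^ (j + 1)).trace := by
            have h := two_mul_trace_mul_le ((Mᵀ * M) ^ 2 ^ j) ((M * Mᵀ) ^ 2 ^ j)
            rw [transpose_pow, transpose_pow, hP.eq, hQ.eq, ← pow_add, ← pow_add,
              trace_mul_pow_comm Mᵀ M, ← two_mul, ← two_mul, ← pow_succ'] at h
            linarith
    · calc ((P * Q) ^ 2 ^ (j + 1)).trace ≤ ((P * Q * (P * Q)ᵀ) ^ 2 ^ j).trace := by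
            rw [pow_succ']; exact hC _
        _ = ((P ^ 2 * Q ^ 2) ^ 2 ^ j).trace := by
            rw [transpose_mul, hP.eq, hQ.eq, show P * Q * (Q * P) = P * (Q * Q * P) by
              simp only [mul_assoc], trace_mul_pow_comm, trace_mul_pow_comm (P ^ 2)]
            simp only [mul_assoc, pow_two]
        _ ≤ ((P ^ 2) ^ 2 ^ j * (Q ^ 2) ^ 2 ^ j).trace := hG _ _ (hP.pow 2) (hQ.pow 2)
        _ = _ := by rw [← pow_mul, ← pow_mul, ← pow_succ']

end Matrix

/-! ### The Lie-Trotter product formula. -/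

namespace NormedSpace

theorem norm_pow_sub_pow_le {𝔸 : Type*} [NormedRing 𝔸] [NormOneClass 𝔸] {x y : 𝔸} {r : ℝ}
    (hx : ‖x‖ ≤ r) (hy : ‖y‖ ≤ r) (hr : 1 ≤ r) (n : ℕ) :
    ‖x ^ n - y ^ n‖ ≤ n * (r ^ n * ‖x - y‖) := by
  have hr0 : 0 ≤ r := zero_le_one.trans hr
  induction n with
  | zero => simp
  | succ n ih =>
    have e : x ^ (n + 1) - y ^ (n + 1) = x ^ n * (x - y) + (x ^ n - y ^ n) * y := by
      rw [pow_succ, pow_succ, mul_sub, sub_mul]; abel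
    have h1 : ‖x ^ n * (x - y)‖ ≤ r ^ (n + 1) * ‖x - y‖ := by
      refine (norm_mul_le _ _).trans (mul_le_mul_of_nonneg_right ?_ (norm_nonneg _))
      exact ((norm_pow_le x n).trans (pow_le_pow_left₀ (norm_nonneg _) hx n)).trans
        (pow_le_pow_right₀ hr n.le_succ)
    have h2 : ‖(x ^ n - y ^ n) * y‖ ≤ n * (r ^ (n + 1) * ‖x - y‖) := by
      refine (norm_mul_le _ _).trans ((mul_le_mul ih hy (norm_nonneg _) (by positivity)).trans
        (le_of_eq ?_))
      ring
    rw [e]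
    refine (norm_add_le _ _).trans ((add_le_add h1 h2).trans (le_of_eq ?_))
    push_cast; ring

variable {𝔸 : Type*} [NormedRing 𝔸] [NormOneClass 𝔸] [NormedAlgebra ℝ 𝔸] [CompleteSpace 𝔸]

theorem norm_exp_le_exp_norm (x : 𝔸) : ‖exp x‖ ≤ Real.exp ‖x‖ := by
  have h1 := exp_series_hasSum_exp' (𝕂 := ℝ) x
  have h2 := exp_series_hasSum_exp' (𝕂 := ℝ) ‖x‖
  rw [← Real.exp_eq_exp_ℝ] at h2
  refine h1.norm_le_of_bounded h2 fun n => ?_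
  rw [norm_smul, smul_eq_mul, Real.norm_of_nonneg (by positivity)]
  exact mul_le_mul_of_nonneg_left (norm_pow_le x n) (by positivity)

/-- The **Lie-Trotter product formula**. -/
theorem tendsto_exp_mul_exp_pow (a b : 𝔸) :
    Filter.Tendsto (fun n : ℕ => (exp ((n : ℝ)⁻¹ • a) * exp ((n : ℝ)⁻¹ • b)) ^ n) Filter.atTop
      (nhds (exp (a + b))) := by
  -- Both curves have velocity `a + b` at `0`, so one factor of the product errs by `o(1/n)`;
  -- telescoping over `n` factors leaves `o(1)`.
  have hd : HasDerivAt (fun t : ℝ => exp (t • a) * exp (t • b) - exp (t • (a + b))) 0 0 := by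
    have h := ((hasDerivAt_exp_smul_const a (0 : ℝ)).mul (hasDerivAt_exp_smul_const b (0 : ℝ))).sub
      (hasDerivAt_exp_smul_const (a + b) (0 : ℝ))
    exact h.congr_deriv (by simp)
  have ht := hd.tendsto_slope_zero
  simp only [zero_add, zero_smul, exp_zero, mul_one, sub_self, sub_zero] at ht
  have hn : Filter.Tendsto (fun n : ℕ => ((n + 1 : ℕ) : ℝ)⁻¹) Filter.atTop
      (nhdsWithin 0 {0}ᶜ) := by
    refine tendsto_nhdsWithin_iff.2 ⟨?_, .of_forall fun n => ?_⟩
    · exact (tendsto_inv_atTop_zero.comp tendsto_natCast_atTop_atTop).comp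
        (Filter.tendsto_add_atTop_nat 1)
    · simp; positivity
  have hc := (ht.comp hn).norm.const_mul (Real.exp (‖a‖ + ‖b‖))
  rw [norm_zero, mul_zero] at hc
  rw [← Filter.tendsto_add_atTop_iff_nat 1, tendsto_iff_norm_sub_tendsto_zero]
  refine squeeze_zero (fun _ => norm_nonneg _) (fun n => ?_) hc
  set N := n + 1
  have hN : (0 : ℝ) < N := by simp only [N]; positivity
  -- A common bound for both factors whose `N`-th power does not depend on `N`.
  set r := Real.exp ((N : ℝ)⁻¹ * (‖a‖ + ‖b‖))
  have hsm (x : 𝔸) : ‖(N : ℝ)⁻¹ • x‖ = (N : ℝ)⁻¹ * ‖x‖ := by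
    rw [norm_smul, Real.norm_of_nonneg (by positivity)]
  have hx : ‖exp ((N : ℝ)⁻¹ • a) * exp ((N : ℝ)⁻¹ • b)‖ ≤ r := by
    refine (norm_mul_le _ _).trans ((mul_le_mul (norm_exp_le_exp_norm _) (norm_exp_le_exp_norm _)
      (norm_nonneg _) (Real.exp_pos _).le).trans (le_of_eq ?_))
    rw [← Real.exp_add, hsm, hsm, ← mul_add]
  have hy : ‖exp ((N : ℝ)⁻¹ • (a + b))‖ ≤ r := by
    refine (norm_exp_le_exp_norm _).trans (Real.exp_le_exp.2 ?_)
    rw [hsm]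
    exact mul_le_mul_of_nonneg_left (norm_add_le _ _) (by positivity)
  have hr : 1 ≤ r := Real.one_le_exp (by positivity)
  have hrN : r ^ N = Real.exp (‖a‖ + ‖b‖) := by
    rw [← Real.exp_nat_mul]; congr 1; field_simp
  have hyN : exp ((N : ℝ)⁻¹ • (a + b)) ^ N = exp (a + b) := by
    let _ : NormedAlgebra ℚ 𝔸 := NormedAlgebra.restrictScalars ℚ ℝ 𝔸
    rw [← exp_nsmul, ← Nat.cast_smul_eq_nsmul ℝ, smul_smul, mul_inv_cancel₀ hN.ne', one_smul]
  have := norm_pow_sub_pow_le hx hy hr N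
  rw [hrN, hyN] at this
  refine this.trans (le_of_eq ?_)
  simp only [Function.comp_apply, norm_smul, Real.norm_natCast, inv_inv]
  ring

end NormedSpace

/-! ### Golden-Thompson and spectral calculus for symmetric matrices. -/

namespace Matrix

open scoped Matrix.Norms.L2Operator

variable {m : Type*} [Fintype m] [DecidableEq m]

theorem IsSymm.exp_smul {A : Matrix m m ℝ} (hA : A.IsSymm) (t : ℝ) :
    (NormedSpace.exp (t • A)).IsSymm := (hA.smul t).exp

/-- The **Golden-Thompson inequality** for real symmetric matrices. -/
theorem trace_exp_add_le [Nonempty m] {A B : Matrix m m ℝ} (hA : A.IsSymm) (hB : B.IsSymm) :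
    (NormedSpace.exp (A + B)).trace ≤ (NormedSpace.exp A * NormedSpace.exp B).trace := by
  -- Only exponents `2 ^ j` are used, where the trace inequality is available; there the upper bound
  -- is constant in `j`.
  have h := (NormedSpace.tendsto_exp_mul_exp_pow A B).comp
    (tendsto_pow_atTop_atTop_of_one_lt (one_lt_two : (1 : ℕ) < 2))
  have ht : Filter.Tendsto (fun M : Matrix m m ℝ => M.trace) (nhds (NormedSpace.exp (A + B)))
      (nhds (NormedSpace.exp (A + B)).trace) := (continuous_id.matrix_trace).tendsto _
  refine le_of_tendsto (ht.comp h) (.of_forall fun j => ?_)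
  have hp (M : Matrix m m ℝ) :
      NormedSpace.exp (((2 ^ j : ℕ) : ℝ)⁻¹ • M) ^ 2 ^ j = NormedSpace.exp M := by
    rw [← Matrix.exp_nsmul, ← Nat.cast_smul_eq_nsmul ℝ, smul_smul, mul_inv_cancel₀ (by positivity),
      one_smul]
  have := (trace_pow_le_and_trace_mul_pow_le j).2 _ _ (hA.exp_smul ((2 ^ j : ℕ) : ℝ)⁻¹)
    (hB.exp_smul ((2 ^ j : ℕ) : ℝ)⁻¹)
  rwa [hp, hp] at this

theorem IsSymm.exists_diagonalization {A : Matrix m m ℝ} (hA : A.IsSymm) :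
    ∃ (U : Matrix m m ℝ) (l : m → ℝ), Uᵀ * U = 1 ∧ U * Uᵀ = 1 ∧ A = U * diagonal l * Uᵀ ∧
      ‖A‖ = ‖l‖ ∧
      ∀ t : ℝ, NormedSpace.exp (t • A) = U * diagonal (fun i => Real.exp (t * l i)) * Uᵀ := by
  have hA' : A.IsHermitian := by rw [IsHermitian, conjTranspose_eq_transpose_of_trivial]; exact hA
  have hs := hA'.spectral_theorem
  set W := hA'.eigenvectorUnitary
  set l := hA'.eigenvalues
  have hst : star (W : Matrix m m ℝ) = (W : Matrix m m ℝ)ᵀ := by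
    rw [star_eq_conjTranspose, conjTranspose_eq_transpose_of_trivial]
  have h1 : (W : Matrix m m ℝ)ᵀ * W = 1 := by rw [← hst]; exact Unitary.coe_star_mul_self W
  have h2 : (W : Matrix m m ℝ) * (W : Matrix m m ℝ)ᵀ = 1 := by
    rw [← hst]; exact Unitary.coe_mul_star_self W
  have h3 : A = W * diagonal l * (W : Matrix m m ℝ)ᵀ := by
    rw [← hst]
    simpa [Unitary.conjStarAlgAut_apply, Function.comp_def] using hs
  refine ⟨W, l, h1, h2, h3, ?_, fun t => ?_⟩
  · conv_lhs => rw [h3, ← hst, ← Unitary.coe_star]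
    rw [CStarRing.norm_mul_coe_unitary, CStarRing.norm_coe_unitary_mul, l2_opNorm_diagonal]
  · have hinv : (W : Matrix m m ℝ)⁻¹ = (W : Matrix m m ℝ)ᵀ := inv_eq_right_inv h2
    have ht : t • A = W * diagonal (t • l) * (W : Matrix m m ℝ)ᵀ := by
      rw [diagonal_smul, Matrix.mul_smul, Matrix.smul_mul, ← h3]
    rw [ht, ← hinv, exp_conj _ _ (IsUnit.of_mul_eq_one _ h2), exp_diagonal, hinv]
    congr 3
    ext i
    rw [Pi.exp_def, Real.exp_eq_exp_ℝ]; rfl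

theorem dotProduct_conj_diagonal_mulVec (U : Matrix m m ℝ) (l x : m → ℝ) :
    x ⬝ᵥ (U * diagonal l * Uᵀ) *ᵥ x = ∑ i, l i * (Uᵀ *ᵥ x) i ^ 2 := by
  rw [← mulVec_mulVec, ← mulVec_mulVec, dotProduct_mulVec, ← mulVec_transpose, dotProduct]
  refine Finset.sum_congr rfl fun i _ => ?_
  rw [mulVec_diagonal]; ring

/-- The scalar bound `exp l ≤ 1 + l + l²` for `|l| ≤ 1`, applied to each eigenvalue. -/
theorem IsSymm.dotProduct_exp_mulVec_le {A : Matrix m m ℝ} (hA : A.IsSymm) (h1 : ‖A‖ ≤ 1)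
    (x : m → ℝ) :
    x ⬝ᵥ NormedSpace.exp A *ᵥ x ≤ x ⬝ᵥ x + x ⬝ᵥ A *ᵥ x + (A *ᵥ x) ⬝ᵥ (A *ᵥ x) := by
  obtain ⟨U, l, hU, hU', hd, hn, he⟩ := hA.exists_diagonalization
  have he1 := he 1
  simp only [one_smul, one_mul] at he1
  have e0 : x ⬝ᵥ x = x ⬝ᵥ (U * diagonal 1 * Uᵀ) *ᵥ x := by
    rw [show (diagonal 1 : Matrix m m ℝ) = 1 from diagonal_one, mul_one, hU', one_mulVec]
  have e2 : (A *ᵥ x) ⬝ᵥ (A *ᵥ x) = x ⬝ᵥ (U * diagonal (l * l) * Uᵀ) *ᵥ x := by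
    have : A * A = U * diagonal (l * l) * Uᵀ := by
      calc A * A = U * diagonal l * (Uᵀ * U) * diagonal l * Uᵀ := by
            conv_lhs => rw [hd]
            simp only [mul_assoc]
        _ = _ := by
          rw [hU, mul_one, mul_assoc U, diagonal_mul_diagonal]; rfl
    rw [← this, ← mulVec_mulVec, dotProduct_mulVec x, ← mulVec_transpose, hA.eq]
  have e1 : x ⬝ᵥ A *ᵥ x = x ⬝ᵥ (U * diagonal l * Uᵀ) *ᵥ x := by rw [← hd]
  rw [he1, e0, e1, e2]
  simp only [dotProduct_conj_diagonal_mulVec, ← Finset.sum_add_distrib, ← add_mul]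
  refine Finset.sum_le_sum fun i _ => mul_le_mul_of_nonneg_right ?_ (sq_nonneg _)
  have hl : |l i| ≤ 1 := (norm_le_pi_norm l i).trans (hn ▸ h1)
  have := (abs_le.1 (Real.abs_exp_sub_one_sub_id_le hl)).2
  simp only [Pi.one_apply, Pi.mul_apply]
  nlinarith

/-- The norm is `|l i|` for some eigenvalue `l i`, and `exp |l i|` is one of the positive terms of
one of the two traces, according to the sign of `l i`. -/
theorem IsSymm.exp_norm_le_trace {A : Matrix m m ℝ} [Nonempty m] (hA : A.IsSymm) :
    Real.exp ‖A‖ ≤ (NormedSpace.exp A).trace + (NormedSpace.exp (-A)).trace := by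
  obtain ⟨U, l, hU, hU', hd, hn, he⟩ := hA.exists_diagonalization
  have ht (f : m → ℝ) : (U * diagonal f * Uᵀ).trace = ∑ i, f i := by
    rw [trace_mul_comm, ← mul_assoc, hU, one_mul, trace_diagonal]
  have h1 := he 1
  have h2 := he (-1)
  rw [one_smul] at h1
  rw [neg_one_smul] at h2
  rw [h1, h2, ht, ht, hn]
  obtain ⟨i, hi⟩ : ∃ i, ‖l‖ = |l i| := by
    obtain ⟨i, -, hi⟩ := Finset.exists_max_image Finset.univ (fun i => |l i|)
      Finset.univ_nonempty
    refine ⟨i, le_antisymm ((pi_norm_le_iff_of_nonneg (abs_nonneg _)).2 fun j => hi j (by simp)) ?_⟩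
    exact norm_le_pi_norm l i
  have p1 := Finset.single_le_sum (f := fun i => Real.exp (1 * l i))
    (fun j _ => (Real.exp_pos _).le) (Finset.mem_univ i)
  have p2 := Finset.single_le_sum (f := fun i => Real.exp (-1 * l i))
    (fun j _ => (Real.exp_pos _).le) (Finset.mem_univ i)
  have := Real.exp_pos (1 * l i)
  have := Real.exp_pos (-1 * l i)
  rcases abs_choice (l i) with h | h <;> rw [hi, h]
  · simp only [one_mul] at *; linarith
  · simp only [neg_one_mul, one_mul] at *; linarith

/-- With `R = exp (H / 2)`, the trace of `R * R * E` is the sum of the quadratic form of `E` over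
the columns of `R`, so only a bound on that form is needed. -/
theorem IsSymm.trace_exp_mul_le {H E : Matrix m m ℝ} (hH : H.IsSymm) {c : ℝ}
    (hE : ∀ x : m → ℝ, x ⬝ᵥ E *ᵥ x ≤ c * (x ⬝ᵥ x)) :
    (NormedSpace.exp H * E).trace ≤ c * (NormedSpace.exp H).trace := by
  set R := NormedSpace.exp ((2 : ℝ)⁻¹ • H)
  have hR : R.IsSymm := hH.exp_smul _
  have hRR : NormedSpace.exp H = R * R := by
    rw [← Matrix.exp_add_of_commute _ _ (Commute.refl _), ← add_smul]
    norm_num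
  have hcol (M : Matrix m m ℝ) :
      (R * R * M).trace = ∑ i, (fun j => R j i) ⬝ᵥ M *ᵥ fun j => R j i := by
    have : (R * R * M).trace = (Rᵀ * (M * R)).trace := by
      rw [hR.eq, mul_assoc, trace_mul_comm R (R * M), mul_assoc]
    rw [this]
    rfl
  have h1 := hcol 1
  simp only [mul_one, one_mulVec] at h1
  rw [hRR, hcol, h1, Finset.mul_sum]
  exact Finset.sum_le_sum fun i _ => hE _

theorem abs_entry_le_l2_opNorm (A : Matrix m m ℝ) (i j : m) : |A i j| ≤ ‖A‖ := by
  have h := l2_opNorm_mulVec A (EuclideanSpace.single j 1)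
  rw [PiLp.norm_single, norm_one, mul_one] at h
  refine le_trans ?_ h
  refine le_trans (le_of_eq ?_) (PiLp.norm_apply_le _ i)
  simp

end Matrix

/-! ### Matrix Bernstein inequality through trace exponentials. -/

namespace Matrix

open ProbabilityTheory
open scoped Matrix.Norms.L2Operator

instance {m n : Type*} : MeasurableSpace (Matrix m n ℝ) :=
  inferInstanceAs (MeasurableSpace (m → n → ℝ))

instance {m n : Type*} [Countable m] [Countable n] : BorelSpace (Matrix m n ℝ) :=
  inferInstanceAs (BorelSpace (m → n → ℝ))

instance {m n : Type*} [Countable m] [Countable n] : SecondCountableTopology (Matrix m n ℝ) :=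
  inferInstanceAs (SecondCountableTopology (m → n → ℝ))

theorem measurable_of_entries {Ω m n : Type*} [MeasurableSpace Ω] {X : Ω → Matrix m n ℝ}
    (h : ∀ i j, Measurable fun ω => X ω i j) : Measurable X :=
  measurable_pi_lambda _ fun i => measurable_pi_lambda _ fun j => h i j

theorem measurable_entry {m n : Type*} (i : m) (j : n) :
    Measurable fun M : Matrix m n ℝ => M i j :=
  (measurable_pi_apply j).comp (measurable_pi_apply i)

theorem isSymm_sum {m ι : Type*} (s : Finset ι) {X : ι → Matrix m m ℝ} (h : ∀ i, (X i).IsSymm) :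
    (∑ i ∈ s, X i).IsSymm := by
  rw [IsSymm, transpose_sum]
  exact Finset.sum_congr rfl fun i _ => h i

variable {m : Type*} [Fintype m] {Ω : Type*} [MeasurableSpace Ω] {μ : Measure Ω}

theorem integrable_dotProduct_mulVec {X : Ω → Matrix m m ℝ}
    (hX : ∀ i j, Integrable (fun ω => X ω i j) μ) (x y : m → ℝ) :
    Integrable (fun ω => x ⬝ᵥ X ω *ᵥ y) μ := by
  simp only [dotProduct, mulVec]
  exact integrable_finsetSum _ fun i _ => (integrable_finsetSum _ fun j _ =>
    (hX i j).mul_const _).const_mul _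

theorem integral_dotProduct_mulVec {X : Ω → Matrix m m ℝ}
    (hX : ∀ i j, Integrable (fun ω => X ω i j) μ) (x y : m → ℝ) :
    ∫ ω, x ⬝ᵥ X ω *ᵥ y ∂μ = x ⬝ᵥ (of fun i j => ∫ ω, X ω i j ∂μ) *ᵥ y := by
  simp only [dotProduct, mulVec, of_apply]
  rw [integral_finsetSum _ fun i _ => (integrable_finsetSum _ fun j _ =>
    (hX i j).mul_const _).const_mul _]
  refine Finset.sum_congr rfl fun i _ => ?_
  rw [integral_const_mul, integral_finsetSum _ fun j _ => (hX i j).mul_const _]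
  simp only [integral_mul_const]

theorem integrable_trace {X : Ω → Matrix m m ℝ}
    (hX : ∀ i j, Integrable (fun ω => X ω i j) μ) : Integrable (fun ω => (X ω).trace) μ := by
  simp only [trace, diag_apply]
  exact integrable_finsetSum _ fun i _ => hX i i

variable [DecidableEq m]

theorem measurable_exp : Measurable (NormedSpace.exp : Matrix m m ℝ → Matrix m m ℝ) := by
  have : NormedAlgebra ℚ (Matrix m m ℝ) := NormedAlgebra.restrictScalars ℚ ℝ _
  exact NormedSpace.exp_continuous.measurable

theorem integrable_entry [IsFiniteMeasure μ] {X : Ω → Matrix m m ℝ} (hX : Measurable X) {R : ℝ}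
    (hR : ∀ᵐ ω ∂μ, ‖X ω‖ ≤ R) (i j : m) : Integrable (fun ω => X ω i j) μ :=
  Integrable.of_bound ((measurable_entry i j).comp hX).aestronglyMeasurable R
    (hR.mono fun _ h => (abs_entry_le_l2_opNorm _ i j).trans h)

theorem integrable_mulVec_dotProduct_mulVec [IsFiniteMeasure μ] {X : Ω → Matrix m m ℝ}
    (hX : Measurable X) {R : ℝ} (hR : ∀ᵐ ω ∂μ, ‖X ω‖ ≤ R) (x : m → ℝ) :
    Integrable (fun ω => (X ω *ᵥ x) ⬝ᵥ (X ω *ᵥ x)) μ := by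
  have e (ω : Ω) : (X ω *ᵥ x) ⬝ᵥ (X ω *ᵥ x) = x ⬝ᵥ ((X ω)ᵀ * X ω) *ᵥ x := by
    rw [← mulVec_mulVec, dotProduct_mulVec x, vecMul_transpose]
  simp only [e]
  refine integrable_dotProduct_mulVec (integrable_entry (R := R * R) ?_ ?_) x x
  · exact (by fun_prop : Continuous fun M : Matrix m m ℝ => Mᵀ * M).measurable.comp hX
  · filter_upwards [hR] with ω h
    refine (l2_opNorm_mul _ _).trans ?_
    rw [← conjTranspose_eq_transpose_of_trivial, l2_opNorm_conjTranspose]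
    exact mul_le_mul h h (norm_nonneg _) ((norm_nonneg _).trans h)

theorem ae_norm_exp_le [Nonempty m] {X : Ω → Matrix m m ℝ} {R : ℝ} (hR : ∀ᵐ ω ∂μ, ‖X ω‖ ≤ R) :
    ∀ᵐ ω ∂μ, ‖NormedSpace.exp (X ω)‖ ≤ Real.exp R :=
  hR.mono fun _ h => (NormedSpace.norm_exp_le_exp_norm _).trans (Real.exp_le_exp.2 h)

theorem integrable_exp_entry [Nonempty m] [IsFiniteMeasure μ] {X : Ω → Matrix m m ℝ}
    (hX : Measurable X) {R : ℝ} (hR : ∀ᵐ ω ∂μ, ‖X ω‖ ≤ R) (i j : m) :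
    Integrable (fun ω => NormedSpace.exp (X ω) i j) μ :=
  integrable_entry (measurable_exp.comp hX) (ae_norm_exp_le hR) i j

theorem dotProduct_integral_exp_mulVec_le [Nonempty m] [IsProbabilityMeasure μ]
    {X : Ω → Matrix m m ℝ} (hX : Measurable X) (hs : ∀ ω, (X ω).IsSymm)
    (hb : ∀ᵐ ω ∂μ, ‖X ω‖ ≤ 1) (h0 : ∀ i j, ∫ ω, X ω i j ∂μ = 0) {v : ℝ}
    (hv : ∀ x : m → ℝ, ∫ ω, (X ω *ᵥ x) ⬝ᵥ (X ω *ᵥ x) ∂μ ≤ v * (x ⬝ᵥ x)) (x : m → ℝ) :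
    x ⬝ᵥ (of fun i j => ∫ ω, NormedSpace.exp (X ω) i j ∂μ) *ᵥ x ≤ (1 + v) * (x ⬝ᵥ x) := by
  have hXi := integrable_entry hX hb
  have hei := integrable_exp_entry hX hb
  have i1 := integrable_dotProduct_mulVec hXi x x
  have i2 := integrable_mulVec_dotProduct_mulVec hX hb x
  rw [← integral_dotProduct_mulVec hei]
  calc ∫ ω, x ⬝ᵥ NormedSpace.exp (X ω) *ᵥ x ∂μ
      ≤ ∫ ω, (x ⬝ᵥ x + x ⬝ᵥ X ω *ᵥ x + (X ω *ᵥ x) ⬝ᵥ (X ω *ᵥ x)) ∂μ :=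
        integral_mono_ae (integrable_dotProduct_mulVec hei x x)
          (((integrable_const _).add i1).add i2)
          (hb.mono fun ω h => (hs ω).dotProduct_exp_mulVec_le h x)
    _ = x ⬝ᵥ x + ∫ ω, (X ω *ᵥ x) ⬝ᵥ (X ω *ᵥ x) ∂μ := by
        have hz : (of fun i j => ∫ ω, X ω i j ∂μ) = (0 : Matrix m m ℝ) := by
          ext i j; exact h0 i j
        have i3 : Integrable (fun ω => x ⬝ᵥ x + x ⬝ᵥ X ω *ᵥ x) μ := (integrable_const _).add i1
        rw [integral_add i3 i2, integral_add (integrable_const _) i1,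
          integral_dotProduct_mulVec hXi, hz]
        simp
    _ ≤ _ := by linarith [hv x]

/-- One peeling step: Golden-Thompson separates the exponentials, independence replaces `exp X` by
its mean, and the quadratic-form bound on that mean pulls out `c`. -/
theorem integral_trace_exp_add_le [Nonempty m] [IsProbabilityMeasure μ]
    {H X : Ω → Matrix m m ℝ} (hH : Measurable H) (hX : Measurable X) (hHX : IndepFun H X μ)
    (hHs : ∀ ω, (H ω).IsSymm) (hs : ∀ ω, (X ω).IsSymm) {R : ℝ} (hHb : ∀ᵐ ω ∂μ, ‖H ω‖ ≤ R)
    (hb : ∀ᵐ ω ∂μ, ‖X ω‖ ≤ 1) {c : ℝ}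
    (hc : ∀ x : m → ℝ,
      x ⬝ᵥ (of fun i j => ∫ ω, NormedSpace.exp (X ω) i j ∂μ) *ᵥ x ≤ c * (x ⬝ᵥ x)) :
    ∫ ω, (NormedSpace.exp (H ω + X ω)).trace ∂μ ≤ c * ∫ ω, (NormedSpace.exp (H ω)).trace ∂μ := by
  have hHi := integrable_exp_entry hH hHb
  have hXi := integrable_exp_entry hX hb
  have hSb : ∀ᵐ ω ∂μ, ‖H ω + X ω‖ ≤ R + 1 := by
    filter_upwards [hHb, hb] with ω h1 h2 using (norm_add_le _ _).trans (add_le_add h1 h2)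
  have hSi := integrable_exp_entry (hH.add hX) hSb
  have hind (i j : m) : IndepFun (fun ω => NormedSpace.exp (H ω) i j)
      (fun ω => NormedSpace.exp (X ω) j i) μ :=
    hHX.comp ((measurable_entry i j).comp measurable_exp) ((measurable_entry j i).comp measurable_exp)
  have hmi (i j : m) : Integrable (fun ω => NormedSpace.exp (H ω) i j * NormedSpace.exp (X ω) j i) μ :=
    (hind i j).integrable_mul (hHi i j) (hXi j i)
  set W : Matrix m m ℝ := of fun i j => ∫ ω, NormedSpace.exp (X ω) i j ∂μ
  calc ∫ ω, (NormedSpace.exp (H ω + X ω)).trace ∂μ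
      ≤ ∫ ω, (NormedSpace.exp (H ω) * NormedSpace.exp (X ω)).trace ∂μ := by
        refine integral_mono (integrable_trace hSi) (integrable_trace fun i j => ?_)
          fun ω => trace_exp_add_le (hHs ω) (hs ω)
        simp only [mul_apply]
        exact integrable_finsetSum _ fun k _ =>
          (hHX.comp ((measurable_entry i k).comp measurable_exp)
            ((measurable_entry k j).comp measurable_exp)).integrable_mul (hHi i k) (hXi k j)
    _ = ∫ ω, (NormedSpace.exp (H ω) * W).trace ∂μ := by
        simp only [trace, diag_apply, mul_apply]
        rw [integral_finsetSum _ fun i _ => integrable_finsetSum _ fun j _ => hmi i j,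
          integral_finsetSum _ fun i _ => integrable_finsetSum _ fun j _ =>
            (hHi i j).mul_const _]
        refine Finset.sum_congr rfl fun i _ => ?_
        rw [integral_finsetSum _ fun j _ => hmi i j,
          integral_finsetSum _ fun j _ => (hHi i j).mul_const _]
        refine Finset.sum_congr rfl fun j _ => ?_
        rw [integral_mul_const, (hind i j).integral_fun_mul_eq_mul_integral
          (hHi i j).aestronglyMeasurable (hXi j i).aestronglyMeasurable]
        rfl
    _ ≤ ∫ ω, c * (NormedSpace.exp (H ω)).trace ∂μ := by
        refine integral_mono (integrable_trace fun i j => ?_) ((integrable_trace hHi).const_mul c)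
          fun ω => (hHs ω).trace_exp_mul_le hc
        simp only [mul_apply]
        exact integrable_finsetSum _ fun k _ => (hHi i k).mul_const _
    _ = _ := integral_const_mul _ _

theorem ae_norm_sum_le {ι : Type*} [Fintype ι] (s : Finset ι) {X : ι → Ω → Matrix m m ℝ} {L : ℝ}
    (hb : ∀ b, ∀ᵐ ω ∂μ, ‖X b ω‖ ≤ L) : ∀ᵐ ω ∂μ, ‖∑ b ∈ s, X b ω‖ ≤ s.card * L := by
  filter_upwards [ae_all_iff.2 hb] with ω h
  refine (norm_sum_le _ _).trans ((Finset.sum_le_sum fun b _ => h b).trans (le_of_eq ?_))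
  simp

/-- Each summand contributes a factor `1 + v ≤ exp v`; the dimension enters only as the trace of
`exp 0`. -/
theorem integral_trace_exp_sum_le [Nonempty m] [IsProbabilityMeasure μ] {ι : Type*} [Fintype ι]
    {X : ι → Ω → Matrix m m ℝ} (hX : ∀ b, Measurable (X b)) (hind : iIndepFun X μ)
    (hs : ∀ b ω, (X b ω).IsSymm)
    (hb : ∀ b, ∀ᵐ ω ∂μ, ‖X b ω‖ ≤ 1) (h0 : ∀ b i j, ∫ ω, X b ω i j ∂μ = 0) {v : ℝ} (hv0 : 0 ≤ v)
    (hv : ∀ b, ∀ x : m → ℝ, ∫ ω, (X b ω *ᵥ x) ⬝ᵥ (X b ω *ᵥ x) ∂μ ≤ v * (x ⬝ᵥ x))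
    (s : Finset ι) :
    ∫ ω, (NormedSpace.exp (∑ b ∈ s, X b ω)).trace ∂μ ≤ Fintype.card m * Real.exp (s.card * v) := by
  classical
  induction s using Finset.induction_on with
  | empty => simp
  | insert b s hbs ih =>
    have hi : IndepFun (fun ω => ∑ b ∈ s, X b ω) (X b) μ := by
      convert hind.indepFun_finsetSum_of_notMem hX hbs using 1
      ext ω; simp
    have := integral_trace_exp_add_le (Finset.measurable_sum s fun b _ => hX b) (hX b) hi
      (fun ω => isSymm_sum s fun b => hs b ω) (hs b) (ae_norm_sum_le s hb) (hb b)
      (dotProduct_integral_exp_mulVec_le (hX b) (hs b) (hb b) (h0 b) (hv b))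
    simp only [Finset.sum_insert hbs, Finset.card_insert_of_notMem hbs, add_comm (X b _)]
    refine this.trans ((mul_le_mul_of_nonneg_left ih (by positivity)).trans ?_)
    have h1 : 1 + v ≤ Real.exp v := by linarith [Real.add_one_le_exp v]
    calc (1 + v) * (Fintype.card m * Real.exp (s.card * v))
        ≤ Real.exp v * (Fintype.card m * Real.exp (s.card * v)) := by gcongr
      _ = Fintype.card m * Real.exp ((s.card + 1 : ℕ) * v) := by
        push_cast
        rw [add_mul, one_mul, Real.exp_add]; ring

/-- A **matrix Bernstein inequality**, with a free parameter `θ`. -/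
theorem measureReal_le_norm_sum_le [Nonempty m] [IsProbabilityMeasure μ] {ι : Type*} [Fintype ι]
    {X : ι → Ω → Matrix m m ℝ} (hX : ∀ b, Measurable (X b)) (hind : iIndepFun X μ)
    (hs : ∀ b ω, (X b ω).IsSymm) {L : ℝ}
    (hb : ∀ b, ∀ᵐ ω ∂μ, ‖X b ω‖ ≤ L) (h0 : ∀ b i j, ∫ ω, X b ω i j ∂μ = 0) {v : ℝ} (hv0 : 0 ≤ v)
    (hv : ∀ b, ∀ x : m → ℝ, ∫ ω, (X b ω *ᵥ x) ⬝ᵥ (X b ω *ᵥ x) ∂μ ≤ v * (x ⬝ᵥ x))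
    {θ : ℝ} (hθ : 0 ≤ θ) (hθL : θ * L ≤ 1) (r : ℝ) :
    μ.real {ω | r ≤ ‖∑ b, X b ω‖} ≤
      2 * Fintype.card m * Real.exp (Fintype.card ι * (θ ^ 2 * v) - θ * r) := by
  -- Both signs `a = ±θ` are needed, to control the largest and the smallest eigenvalue of the sum.
  have key (a : ℝ) (ha : |a| = θ) :
      Integrable (fun ω => (NormedSpace.exp (a • ∑ b, X b ω)).trace) μ ∧
      ∫ ω, (NormedSpace.exp (a • ∑ b, X b ω)).trace ∂μ ≤
        Fintype.card m * Real.exp (Fintype.card ι * (θ ^ 2 * v)) := by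
    have hm (b : ι) : Measurable fun ω => a • X b ω := (hX b).const_smul a
    have hb' (b : ι) : ∀ᵐ ω ∂μ, ‖a • X b ω‖ ≤ 1 := by
      filter_upwards [hb b] with ω h
      rw [norm_smul, Real.norm_eq_abs, ha]
      exact (mul_le_mul_of_nonneg_left h hθ).trans hθL
    have hi : iIndepFun (fun b ω => a • X b ω) μ :=
      hind.comp (fun _ M => a • M) fun _ => measurable_const_smul a
    simp only [Finset.smul_sum]
    refine ⟨integrable_trace (integrable_exp_entry
      (Finset.measurable_sum _ fun b _ => hm b) (ae_norm_sum_le _ hb')), ?_⟩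
    refine integral_trace_exp_sum_le hm hi (fun b ω => (hs b ω).smul a) hb' (fun b i j => ?_)
      (by positivity) (fun b x => ?_) Finset.univ
    · simp only [smul_apply, integral_smul, h0, smul_zero]
    · simp only [smul_mulVec, smul_dotProduct, dotProduct_smul, smul_eq_mul, integral_const_mul]
      rw [← mul_assoc, ← sq, ← sq_abs, ha, mul_assoc]
      exact mul_le_mul_of_nonneg_left (hv b x) (sq_nonneg _)
  obtain ⟨i1, h1⟩ := key θ (abs_of_nonneg hθ)
  obtain ⟨i2, h2⟩ := key (-θ) (by rw [abs_neg, abs_of_nonneg hθ])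
  set F : Ω → ℝ := fun ω => (NormedSpace.exp (θ • ∑ b, X b ω)).trace +
    (NormedSpace.exp (-θ • ∑ b, X b ω)).trace
  have hF (ω : Ω) : Real.exp (θ * ‖∑ b, X b ω‖) ≤ F ω := by
    have := ((isSymm_sum Finset.univ fun b => hs b ω).smul θ).exp_norm_le_trace
    rwa [norm_smul, Real.norm_of_nonneg hθ, ← neg_smul] at this
  have hM := mul_meas_ge_le_integral_of_nonneg (μ := μ) (f := F)
    (.of_forall fun ω => (Real.exp_pos _).le.trans (hF ω)) (i1.add i2) (Real.exp (θ * r))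
  have hsub : μ.real {ω | r ≤ ‖∑ b, X b ω‖} ≤ μ.real {ω | Real.exp (θ * r) ≤ F ω} :=
    measureReal_mono fun ω h =>
      (Real.exp_le_exp.2 (mul_le_mul_of_nonneg_left h hθ)).trans (hF ω)
  have hI : ∫ ω, F ω ∂μ ≤ 2 * Fintype.card m * Real.exp (Fintype.card ι * (θ ^ 2 * v)) := by
    rw [integral_add i1 i2]; linarith
  rw [Real.exp_sub, mul_div_assoc', le_div_iff₀ (Real.exp_pos _), mul_comm]
  exact (mul_le_mul_of_nonneg_left hsub (Real.exp_pos _).le).trans (hM.trans hI)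

end Matrix

/-! ### Moments of clipped gradients. -/

noncomputable section

namespace GradSub

open ProbabilityTheory
open scoped Matrix Matrix.Norms.L2Operator

variable {d : ℕ}

theorem norm_sq_eq_dotProduct (x : EuclideanSpace ℝ (Fin d)) : ‖x‖ ^ 2 = x.ofLp ⬝ᵥ x.ofLp := by
  rw [← real_inner_self_eq_norm_sq, EuclideanSpace.inner_eq_star_dotProduct, star_trivial]

theorem abs_apply_le_norm (x : EuclideanSpace ℝ (Fin d)) (i : Fin d) : |x i| ≤ ‖x‖ :=
  PiLp.norm_apply_le x i

theorem sq_dotProduct_le (x y : EuclideanSpace ℝ (Fin d)) :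
    (x.ofLp ⬝ᵥ y.ofLp) ^ 2 ≤ (‖x‖ * ‖y‖) ^ 2 := by
  have := abs_real_inner_le_norm y x
  rw [EuclideanSpace.inner_eq_star_dotProduct, star_trivial] at this
  rw [← sq_abs, mul_comm ‖x‖]
  gcongr

theorem measurable_coord {Ω : Type*} [MeasurableSpace Ω] {f : Ω → EuclideanSpace ℝ (Fin d)}
    (hf : Measurable f) (i : Fin d) : Measurable fun ω => f ω i := by
  fun_prop

theorem measurable_clippedGrad (w : EuclideanSpace ℝ (Fin d)) (κ : ℝ) :
    Measurable (clippedGrad w κ) := by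
  unfold clippedGrad
  fun_prop

theorem abs_clip_le (a : ℝ) {κ : ℝ} (hκ : 0 < κ) : |a / max |a| κ * κ| ≤ κ := by
  have hm : 0 < max |a| κ := lt_max_of_lt_right hκ
  rw [abs_mul, abs_div, abs_of_pos hm, abs_of_pos hκ]
  exact mul_le_of_le_one_left hκ.le ((div_le_one hm).2 (le_max_left _ _))

theorem norm_clippedGrad_le (w : EuclideanSpace ℝ (Fin d)) {κ : ℝ} (hκ : 0 < κ) (p : Sample d) :
    ‖clippedGrad w κ p‖ ≤ κ * ‖p.1‖ := by
  rw [clippedGrad, norm_smul, Real.norm_eq_abs]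
  exact mul_le_mul_of_nonneg_right (abs_clip_le _ hκ) (norm_nonneg _)

theorem sq_clippedGrad_dotProduct_le (w : EuclideanSpace ℝ (Fin d)) {κ : ℝ} (hκ : 0 < κ)
    (p : Sample d) (x : Fin d → ℝ) :
    ((clippedGrad w κ p).ofLp ⬝ᵥ x) ^ 2 ≤ κ ^ 2 * (p.1.ofLp ⬝ᵥ x) ^ 2 := by
  rw [clippedGrad, WithLp.ofLp_smul, smul_dotProduct, smul_eq_mul, mul_pow, ← sq_abs (_ * κ)]
  gcongr
  exact abs_clip_le _ hκ

theorem ae_norm_clippedGrad_le {D : Measure (Sample d)} {R : ℝ} (hb : ∀ᵐ p ∂D, ‖p.1‖ ≤ R)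
    (w : EuclideanSpace ℝ (Fin d)) {κ : ℝ} (hκ : 0 < κ) :
    ∀ᵐ p ∂D, ‖clippedGrad w κ p‖ ≤ κ * R :=
  hb.mono fun p h => (norm_clippedGrad_le w hκ p).trans (mul_le_mul_of_nonneg_left h hκ.le)

theorem integrable_sq_dotProduct {Ω : Type*} [MeasurableSpace Ω] {μ : Measure Ω}
    [IsFiniteMeasure μ] {f : Ω → EuclideanSpace ℝ (Fin d)} (hf : Measurable f) {R : ℝ}
    (hR : ∀ᵐ ω ∂μ, ‖f ω‖ ≤ R) (x : Fin d → ℝ) :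
    Integrable (fun ω => ((f ω).ofLp ⬝ᵥ x) ^ 2) μ := by
  refine Integrable.of_bound (C := (R * ‖WithLp.toLp 2 x‖) ^ 2) ?_ (hR.mono fun ω h => ?_)
  · refine Measurable.aestronglyMeasurable ?_
    simp only [dotProduct]
    fun_prop
  · rw [Real.norm_of_nonneg (sq_nonneg _)]
    refine (sq_dotProduct_le (f ω) (WithLp.toLp 2 x)).trans ?_
    gcongr

theorem integral_sq_dotProduct_le {D : Measure (Sample d)} [IsProbabilityMeasure D] {C R : ℝ}
    (hS : spectralNorm (secondMoment D) ≤ C) (hb : ∀ᵐ p ∂D, ‖p.1‖ ≤ R) (x : Fin d → ℝ) :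
    ∫ p, (p.1.ofLp ⬝ᵥ x) ^ 2 ∂D ≤ C * (x ⬝ᵥ x) := by
  have hi (i j : Fin d) : Integrable (fun p : Sample d =>
      Matrix.vecMulVec p.1.ofLp p.1.ofLp i j) D := by
    refine Integrable.of_bound (C := R * R) ?_ (hb.mono fun p h => ?_)
    · refine Measurable.aestronglyMeasurable ?_
      simp only [Matrix.vecMulVec_apply]
      fun_prop
    · rw [Matrix.vecMulVec_apply, norm_mul]
      exact mul_le_mul ((abs_apply_le_norm _ _).trans h) ((abs_apply_le_norm _ _).trans h)
        (norm_nonneg _) ((norm_nonneg _).trans h)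
  have e (p : Sample d) : (p.1.ofLp ⬝ᵥ x) ^ 2 =
      x ⬝ᵥ Matrix.vecMulVec p.1.ofLp p.1.ofLp *ᵥ x := by
    rw [Matrix.vecMulVec_mulVec]
    simp [dotProduct_comm x, sq]
  simp only [e]
  rw [Matrix.integral_dotProduct_mulVec hi]
  have hM : (Matrix.of fun i j => ∫ p : Sample d, Matrix.vecMulVec p.1.ofLp p.1.ofLp i j ∂D) =
      secondMoment D := by
    ext i j; rfl
  rw [hM]
  set y := WithLp.toLp 2 x
  have h1 := real_inner_le_norm y (Matrix.toEuclideanCLM (n := Fin d) (𝕜 := ℝ) (secondMoment D) y)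
  rw [Matrix.inner_toEuclideanCLM] at h1
  have h2 := (Matrix.toEuclideanCLM (n := Fin d) (𝕜 := ℝ) (secondMoment D)).le_opNorm y
  have h3 : ‖y‖ ^ 2 = x ⬝ᵥ x := norm_sq_eq_dotProduct y
  rw [← h3]
  calc _ ≤ ‖y‖ * (spectralNorm (secondMoment D) * ‖y‖) :=
        h1.trans (mul_le_mul_of_nonneg_left h2 (norm_nonneg _))
    _ ≤ ‖y‖ * (C * ‖y‖) := by gcongr
    _ = _ := by ring

theorem integral_sq_clippedGrad_dotProduct_le {D : Measure (Sample d)} [IsProbabilityMeasure D]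
    {C R : ℝ} (hS : spectralNorm (secondMoment D) ≤ C) (hb : ∀ᵐ p ∂D, ‖p.1‖ ≤ R)
    (w : EuclideanSpace ℝ (Fin d)) {κ : ℝ} (hκ : 0 < κ) (x : Fin d → ℝ) :
    ∫ p, ((clippedGrad w κ p).ofLp ⬝ᵥ x) ^ 2 ∂D ≤ κ ^ 2 * C * (x ⬝ᵥ x) := by
  calc _ ≤ ∫ p, κ ^ 2 * (p.1.ofLp ⬝ᵥ x) ^ 2 ∂D :=
        integral_mono (integrable_sq_dotProduct (measurable_clippedGrad w κ)
          (ae_norm_clippedGrad_le hb w hκ) x)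
          ((integrable_sq_dotProduct measurable_fst hb x).const_mul _)
          fun p => sq_clippedGrad_dotProduct_le w hκ p x
    _ ≤ _ := by
        rw [integral_const_mul, mul_assoc]
        exact mul_le_mul_of_nonneg_left (integral_sq_dotProduct_le hS hb x) (sq_nonneg _)

theorem integrable_of_ae_norm_le {Ω : Type*} [MeasurableSpace Ω] {μ : Measure Ω}
    [IsFiniteMeasure μ] {f : Ω → EuclideanSpace ℝ (Fin d)} (hf : Measurable f) {R : ℝ}
    (hR : ∀ᵐ ω ∂μ, ‖f ω‖ ≤ R) : Integrable f μ :=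
  Integrable.of_bound hf.aestronglyMeasurable R hR

theorem integral_ofLp {Ω : Type*} [MeasurableSpace Ω] {μ : Measure Ω}
    {f : Ω → EuclideanSpace ℝ (Fin d)} (hf : Integrable f μ) (i : Fin d) :
    (∫ ω, f ω ∂μ) i = ∫ ω, f ω i ∂μ :=
  ((EuclideanSpace.proj (𝕜 := ℝ) i).integral_comp_comm hf).symm

theorem integral_norm_sq_le {Ω : Type*} [MeasurableSpace Ω] {μ : Measure Ω}
    [IsFiniteMeasure μ] {f : Ω → EuclideanSpace ℝ (Fin d)} (hf : Measurable f) {R s : ℝ}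
    (hR : ∀ᵐ ω ∂μ, ‖f ω‖ ≤ R)
    (hs : ∀ x : Fin d → ℝ, ∫ ω, ((f ω).ofLp ⬝ᵥ x) ^ 2 ∂μ ≤ s * (x ⬝ᵥ x)) :
    ∫ ω, (f ω).ofLp ⬝ᵥ (f ω).ofLp ∂μ ≤ d * s := by
  have e (ω : Ω) : (f ω).ofLp ⬝ᵥ (f ω).ofLp =
      ∑ i, ((f ω).ofLp ⬝ᵥ Pi.single i (1 : ℝ)) ^ 2 := by
    simp only [dotProduct_single_one, sq]; rfl
  simp only [e]
  rw [integral_finsetSum _ fun i _ => integrable_sq_dotProduct hf hR _]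
  refine (Finset.sum_le_sum fun i _ => hs (Pi.single i 1)).trans (le_of_eq ?_)
  simp

/-- Jensen's inequality. -/
theorem norm_sq_integral_le {Ω : Type*} [MeasurableSpace Ω] {μ : Measure Ω}
    [IsProbabilityMeasure μ] {f : Ω → EuclideanSpace ℝ (Fin d)} (hf : Measurable f) {R s : ℝ}
    (hR : ∀ᵐ ω ∂μ, ‖f ω‖ ≤ R) (h0 : 0 ≤ s)
    (hs : ∀ x : Fin d → ℝ, ∫ ω, ((f ω).ofLp ⬝ᵥ x) ^ 2 ∂μ ≤ s * (x ⬝ᵥ x)) :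
    ‖∫ ω, f ω ∂μ‖ ^ 2 ≤ s := by
  set g := ∫ ω, f ω ∂μ
  have hfi := integrable_of_ae_norm_le hf hR
  have hin (ω : Ω) : inner ℝ g (f ω) = (f ω).ofLp ⬝ᵥ g.ofLp := by
    rw [EuclideanSpace.inner_eq_star_dotProduct, star_trivial]
  have h1 : ∫ ω, inner ℝ g (f ω) ∂μ = ‖g‖ ^ 2 := by
    rw [integral_inner hfi, real_inner_self_eq_norm_sq]
  -- The test direction is the mean itself: nonnegativity of the variance of `⟨g, f⟩` gives `‖g‖⁴ ≤
  -- s ‖g‖²`.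
  have hsg := hs g.ofLp
  simp only [← hin, ← norm_sq_eq_dotProduct] at hsg
  have hsqi : Integrable (fun ω => inner ℝ g (f ω) ^ 2) μ := by
    simp only [hin]; exact integrable_sq_dotProduct hf hR _
  have hpos : 0 ≤ ∫ ω, (inner ℝ g (f ω) - ‖g‖ ^ 2) ^ 2 ∂μ := integral_nonneg fun _ => sq_nonneg _
  have hii : Integrable (fun ω => inner ℝ g (f ω)) μ := hfi.const_inner g
  have e : ∫ ω, (inner ℝ g (f ω) - ‖g‖ ^ 2) ^ 2 ∂μ =
      ∫ ω, inner ℝ g (f ω) ^ 2 ∂μ - ‖g‖ ^ 2 * ‖g‖ ^ 2 := by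
    have : ∀ ω, (inner ℝ g (f ω) - ‖g‖ ^ 2) ^ 2 =
        inner ℝ g (f ω) ^ 2 - 2 * ‖g‖ ^ 2 * inner ℝ g (f ω) + ‖g‖ ^ 2 * ‖g‖ ^ 2 := fun ω => by ring
    simp only [this]
    have i1 : Integrable (fun ω => inner ℝ g (f ω) ^ 2 - 2 * ‖g‖ ^ 2 * inner ℝ g (f ω)) μ :=
      hsqi.sub (hii.const_mul _)
    rw [integral_add i1 (integrable_const _), integral_sub hsqi (hii.const_mul _),
      integral_const_mul, h1]
    simp; ring
  rw [e] at hpos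
  by_contra! hlt
  nlinarith [mul_lt_mul_of_pos_right hlt (h0.trans_lt hlt)]

theorem integral_pi_eval {ι : Type*} [Fintype ι] {Ω : ι → Type*} [∀ i, MeasurableSpace (Ω i)]
    (μ : ∀ i, Measure (Ω i)) [∀ i, IsProbabilityMeasure (μ i)] (j : ι) {F : Ω j → ℝ}
    (hF : Measurable F) : ∫ S, F (S j) ∂(Measure.pi μ) = ∫ p, F p ∂(μ j) := by
  have h := integral_map (μ := Measure.pi μ) (measurable_pi_apply j).aemeasurable
    (f := F) hF.aestronglyMeasurable
  rw [← h]
  exact congrArg (fun ν => ∫ p, F p ∂ν) (measurePreserving_eval μ j).map_eq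

/-! ### Mean, size and second moment of the contribution of one batch. -/

section Batch

variable {n : ℕ} {D : Measure (Sample d)} [IsProbabilityMeasure D]
  {w : EuclideanSpace ℝ (Fin d)} {κ R s : ℝ}

theorem measurable_clippedGradAvg (w : EuclideanSpace ℝ (Fin d)) (κ : ℝ) (T : Finset (Fin n)) :
    Measurable fun S : Fin n → Sample d => clippedGradAvg w κ S T := by
  unfold clippedGradAvg
  have h : Measurable fun S : Fin n → Sample d => ∑ j ∈ T, clippedGrad w κ (S j) :=
    Finset.measurable_sum T fun j _ => (measurable_clippedGrad w κ).comp (measurable_pi_apply j)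
  exact h.const_smul (T.card : ℝ)⁻¹

theorem ae_pi_norm_clippedGrad_le (hR : ∀ᵐ p ∂D, ‖clippedGrad w κ p‖ ≤ R) :
    ∀ᵐ S ∂(Measure.pi fun _ : Fin n => D), ∀ j, ‖clippedGrad w κ (S j)‖ ≤ R :=
  ae_all_iff.2 fun j => (measurePreserving_eval (fun _ : Fin n => D) j).quasiMeasurePreserving.ae hR

theorem norm_clippedGradAvg_le {S : Fin n → Sample d} (h : ∀ j, ‖clippedGrad w κ (S j)‖ ≤ R)
    {T : Finset (Fin n)} (hT : T.Nonempty) : ‖clippedGradAvg w κ S T‖ ≤ R := by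
  have hc : (0 : ℝ) < T.card := by exact_mod_cast hT.card_pos
  rw [clippedGradAvg, norm_smul, norm_inv, Real.norm_natCast, inv_mul_le_iff₀ hc]
  exact (norm_sum_le _ _).trans ((Finset.sum_le_sum fun j _ => h j).trans (le_of_eq (by simp)))

theorem integral_clippedGradAvg (hR : ∀ᵐ p ∂D, ‖clippedGrad w κ p‖ ≤ R)
    {T : Finset (Fin n)} (hT : T.Nonempty) (i : Fin d) :
    ∫ S, clippedGradAvg w κ S T i ∂(Measure.pi fun _ : Fin n => D) =
      (∫ p, clippedGrad w κ p ∂D) i := by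
  have hc : (0 : ℝ) < T.card := by exact_mod_cast hT.card_pos
  have hm : Measurable fun p => clippedGrad w κ p i := by
    have := measurable_clippedGrad w κ
    fun_prop
  rw [integral_ofLp (integrable_of_ae_norm_le (measurable_clippedGrad w κ) hR)]
  simp only [clippedGradAvg, PiLp.smul_apply, WithLp.ofLp_sum, Finset.sum_apply, smul_eq_mul]
  rw [integral_const_mul, integral_finsetSum]
  · rw [Finset.sum_congr rfl fun j _ => integral_pi_eval (fun _ => D) j hm]
    simp [hc.ne']
  · intro j _
    refine Integrable.of_bound (C := R) (hm.comp (measurable_pi_apply j)).aestronglyMeasurable ?_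
    exact (ae_pi_norm_clippedGrad_le hR).mono fun S h => (abs_apply_le_norm _ _).trans (h j)

/-- Averaging does not increase second moments, by convexity of the square; no gain from the size of
`T` is needed. -/
theorem integral_sq_clippedGradAvg_dotProduct_le (hR : ∀ᵐ p ∂D, ‖clippedGrad w κ p‖ ≤ R)
    (hs : ∀ x : Fin d → ℝ, ∫ p, ((clippedGrad w κ p).ofLp ⬝ᵥ x) ^ 2 ∂D ≤ s * (x ⬝ᵥ x))
    {T : Finset (Fin n)} (hT : T.Nonempty) (x : Fin d → ℝ) :
    ∫ S, ((clippedGradAvg w κ S T).ofLp ⬝ᵥ x) ^ 2 ∂(Measure.pi fun _ : Fin n => D) ≤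
      s * (x ⬝ᵥ x) := by
  have hc : (0 : ℝ) < T.card := by exact_mod_cast hT.card_pos
  have hm : Measurable fun p => ((clippedGrad w κ p).ofLp ⬝ᵥ x) ^ 2 := by
    have := measurable_clippedGrad w κ
    simp only [dotProduct]
    fun_prop
  have hi (j : Fin n) : Integrable (fun S : Fin n → Sample d =>
      ((clippedGrad w κ (S j)).ofLp ⬝ᵥ x) ^ 2) (Measure.pi fun _ : Fin n => D) :=
    integrable_sq_dotProduct ((measurable_clippedGrad w κ).comp (measurable_pi_apply j))
      ((ae_pi_norm_clippedGrad_le hR).mono fun S h => h j) x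
  have hpt (S : Fin n → Sample d) : ((clippedGradAvg w κ S T).ofLp ⬝ᵥ x) ^ 2 ≤
      (T.card : ℝ)⁻¹ * ∑ j ∈ T, ((clippedGrad w κ (S j)).ofLp ⬝ᵥ x) ^ 2 := by
    have := sq_sum_le_card_mul_sum_sq (s := T) (f := fun j => (clippedGrad w κ (S j)).ofLp ⬝ᵥ x)
    rw [clippedGradAvg, WithLp.ofLp_smul, smul_dotProduct, WithLp.ofLp_sum, sum_dotProduct,
      smul_eq_mul, mul_pow, sq, mul_assoc]
    gcongr
    rwa [inv_mul_le_iff₀ hc]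
  calc _ ≤ ∫ S, (T.card : ℝ)⁻¹ * ∑ j ∈ T, ((clippedGrad w κ (S j)).ofLp ⬝ᵥ x) ^ 2
          ∂(Measure.pi fun _ : Fin n => D) := by
        refine integral_mono (integrable_sq_dotProduct (measurable_clippedGradAvg w κ T)
          ((ae_pi_norm_clippedGrad_le hR).mono fun S h => norm_clippedGradAvg_le h hT) x)
          ((integrable_finsetSum _ fun j _ => hi j).const_mul _) hpt
    _ = ∫ p, ((clippedGrad w κ p).ofLp ⬝ᵥ x) ^ 2 ∂D := by
        rw [integral_const_mul, integral_finsetSum _ fun j _ => hi j,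
          Finset.sum_congr rfl fun j _ => integral_pi_eval (fun _ => D) j hm]
        simp [hc.ne']
    _ ≤ _ := hs x

theorem indepFun_clippedGradAvg {T T' : Finset (Fin n)} (h : Disjoint T T') :
    IndepFun (fun S => clippedGradAvg w κ S T) (fun S => clippedGradAvg w κ S T')
      (Measure.pi fun _ : Fin n => D) := by
  have hind : iIndepFun (fun (j : Fin n) (S : Fin n → Sample d) => clippedGrad w κ (S j))
      (Measure.pi fun _ : Fin n => D) :=
    iIndepFun_pi fun _ => (measurable_clippedGrad w κ).aemeasurable
  have h2 := hind.indepFun_finset T T' h fun j =>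
    (measurable_clippedGrad w κ).comp (measurable_pi_apply j)
  have hφ (T : Finset (Fin n)) : Measurable fun f : T → EuclideanSpace ℝ (Fin d) =>
      (T.card : ℝ)⁻¹ • ∑ j, f j := by
    have h : Measurable fun f : T → EuclideanSpace ℝ (Fin d) => ∑ j, f j :=
      Finset.measurable_sum _ fun j _ => measurable_pi_apply j
    exact h.const_smul (T.card : ℝ)⁻¹
  have h3 := h2.comp (hφ T) (hφ T')
  have e (T : Finset (Fin n)) : (fun S : Fin n → Sample d => clippedGradAvg w κ S T) =
      (fun f : T → EuclideanSpace ℝ (Fin d) => (T.card : ℝ)⁻¹ • ∑ j, f j) ∘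
        fun S j => clippedGrad w κ (S j) := by
    ext1 S
    simp only [clippedGradAvg, Function.comp_apply]
    rw [Finset.sum_coe_sort T fun j => clippedGrad w κ (S j)]
  rw [e, e]
  exact h3

/-- The symmetrized product of the clipped gradients of the two parts of a batch. -/
def symmOuter (u v : EuclideanSpace ℝ (Fin d)) : Matrix (Fin d) (Fin d) ℝ :=
  (2 : ℝ)⁻¹ • (Matrix.vecMulVec u.ofLp v.ofLp + Matrix.vecMulVec v.ofLp u.ofLp)

theorem isSymm_symmOuter (u v : EuclideanSpace ℝ (Fin d)) : (symmOuter u v).IsSymm := by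
  ext i j
  simp only [symmOuter, Matrix.transpose_apply, Matrix.smul_apply, Matrix.add_apply,
    Matrix.vecMulVec_apply]
  ring_nf

theorem symmOuter_mulVec (u v : EuclideanSpace ℝ (Fin d)) (x : Fin d → ℝ) :
    symmOuter u v *ᵥ x = (2 : ℝ)⁻¹ • ((v.ofLp ⬝ᵥ x) • u.ofLp + (u.ofLp ⬝ᵥ x) • v.ofLp) := by
  ext i
  simp only [symmOuter, Matrix.smul_mulVec, Matrix.add_mulVec, Matrix.vecMulVec_mulVec]
  simp

/-- The image of `x` is the midpoint of `(v·x) u` and `(u·x) v`, and the squared norm is convex. -/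
theorem symmOuter_mulVec_dotProduct_self_le (u v : EuclideanSpace ℝ (Fin d)) (x : Fin d → ℝ) :
    (symmOuter u v *ᵥ x) ⬝ᵥ (symmOuter u v *ᵥ x) ≤
      2⁻¹ * ((u.ofLp ⬝ᵥ u.ofLp) * (v.ofLp ⬝ᵥ x) ^ 2 +
        (v.ofLp ⬝ᵥ v.ofLp) * (u.ofLp ⬝ᵥ x) ^ 2) := by
  rw [symmOuter_mulVec]
  have h : 0 ≤ ((v.ofLp ⬝ᵥ x) • u.ofLp - (u.ofLp ⬝ᵥ x) • v.ofLp) ⬝ᵥ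
      ((v.ofLp ⬝ᵥ x) • u.ofLp - (u.ofLp ⬝ᵥ x) • v.ofLp) :=
    Finset.sum_nonneg fun i _ => mul_self_nonneg _
  simp only [sub_dotProduct, dotProduct_sub, add_dotProduct, dotProduct_add, smul_dotProduct,
    dotProduct_smul, smul_eq_mul, dotProduct_comm v.ofLp u.ofLp] at h ⊢
  nlinarith

theorem norm_symmOuter_le (u v : EuclideanSpace ℝ (Fin d)) : ‖symmOuter u v‖ ≤ ‖u‖ * ‖v‖ := by
  rw [Matrix.cstar_norm_def]
  refine ContinuousLinearMap.opNorm_le_bound _ (by positivity) fun x => ?_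
  refine abs_le_of_sq_le_sq' ?_ (by positivity) |>.2
  rw [norm_sq_eq_dotProduct, Matrix.ofLp_toEuclideanCLM]
  refine (symmOuter_mulVec_dotProduct_self_le u v x.ofLp).trans ?_
  rw [← norm_sq_eq_dotProduct, ← norm_sq_eq_dotProduct]
  have h1 := mul_le_mul_of_nonneg_left (sq_dotProduct_le v x) (sq_nonneg ‖u‖)
  have h2 := mul_le_mul_of_nonneg_left (sq_dotProduct_le u x) (sq_nonneg ‖v‖)
  nlinarith

/-- The contribution of a divided batch to the gradient matrix. -/
def batchMatrix (w : EuclideanSpace ℝ (Fin d)) (κ : ℝ) (B : SplitBatch d n) :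
    Matrix (Fin d) (Fin d) ℝ :=
  symmOuter (clippedGradAvg w κ B.1 B.2.fst) (clippedGradAvg w κ B.1 B.2.snd)

theorem Split.fst_nonempty (hn : 2 ≤ n) (T : Split n) : T.fst.Nonempty := by
  rw [← Finset.card_pos, Split.fst, T.2]; omega

theorem Split.snd_nonempty (hn : 2 ≤ n) (T : Split n) : T.snd.Nonempty := by
  rw [← Finset.card_pos, Split.snd, Finset.card_compl, T.2, Fintype.card_fin]; omega

theorem Split.disjoint (T : Split n) : Disjoint T.fst T.snd := disjoint_compl_right

theorem measurable_batchMatrix (w : EuclideanSpace ℝ (Fin d)) (κ : ℝ) :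
    Measurable (batchMatrix w κ : SplitBatch d n → Matrix (Fin d) (Fin d) ℝ) := by
  refine Matrix.measurable_of_entries fun i j => measurable_from_prod_countable_left fun T => ?_
  have h1 := measurable_coord (measurable_clippedGradAvg (d := d) w κ T.fst)
  have h2 := measurable_coord (measurable_clippedGradAvg (d := d) w κ T.snd)
  exact (((h1 i).mul (h2 j)).add ((h2 i).mul (h1 j))).const_smul (2 : ℝ)⁻¹

theorem ae_batchLaw_norm_le (hR : ∀ᵐ p ∂D, ‖clippedGrad w κ p‖ ≤ R) :
    ∀ᵐ B ∂(batchLaw n D), ∀ j, ‖clippedGrad w κ (B.1 j)‖ ≤ R :=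
  Measure.quasiMeasurePreserving_fst.ae (ae_pi_norm_clippedGrad_le hR)

theorem ae_norm_batchMatrix_le (hn : 2 ≤ n) (hR : ∀ᵐ p ∂D, ‖clippedGrad w κ p‖ ≤ R) :
    ∀ᵐ B ∂(batchLaw n D), ‖batchMatrix w κ B‖ ≤ R ^ 2 := by
  filter_upwards [ae_batchLaw_norm_le hR] with B h
  have h1 := norm_clippedGradAvg_le h (B.2.fst_nonempty hn)
  have h2 := norm_clippedGradAvg_le h (B.2.snd_nonempty hn)
  rw [sq]
  exact (norm_symmOuter_le _ _).trans (mul_le_mul h1 h2 (norm_nonneg _) ((norm_nonneg _).trans h1))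

theorem integral_batchLaw {F : SplitBatch d n → ℝ} (hF : Integrable F (batchLaw n D)) :
    ∫ B, F B ∂(batchLaw n D) =
      ∫ T, ∫ S, F (S, T) ∂(Measure.pi fun _ : Fin n => D)
        ∂(PMF.uniformOfFintype (Split n)).toMeasure :=
  integral_prod_symm F hF

/-- This is why batches are split: for every fixed division the two averages are independent, so the
product of their entries is unbiased for the rank-one matrix of the mean. -/
theorem integral_batchMatrix (hn : 2 ≤ n) (hR : ∀ᵐ p ∂D, ‖clippedGrad w κ p‖ ≤ R) (i j : Fin d) :
    ∫ B, batchMatrix w κ B i j ∂(batchLaw n D) =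
      (∫ p, clippedGrad w κ p ∂D) i * (∫ p, clippedGrad w κ p ∂D) j := by
  set g := ∫ p, clippedGrad w κ p ∂D
  rw [integral_batchLaw (Matrix.integrable_entry (measurable_batchMatrix w κ)
    (ae_norm_batchMatrix_le hn hR) i j)]
  have hi (T : Finset (Fin n)) (hT : T.Nonempty) (i : Fin d) :
      Integrable (fun S => clippedGradAvg w κ S T i) (Measure.pi fun _ : Fin n => D) := by
    refine Integrable.of_bound (C := R) (measurable_coord
      (measurable_clippedGradAvg (d := d) w κ T) i).aestronglyMeasurable ((ae_pi_norm_clippedGrad_le hR).mono fun S h =>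
      (abs_apply_le_norm _ _).trans (norm_clippedGradAvg_le h hT))
  have key (T : Split n) : ∫ S, batchMatrix w κ (S, T) i j ∂(Measure.pi fun _ : Fin n => D) =
      g i * g j := by
    have hp (i : Fin d) : Measurable fun x : EuclideanSpace ℝ (Fin d) => x i := by fun_prop
    have hind (i j : Fin d) : IndepFun (fun S => clippedGradAvg w κ S T.fst i)
        (fun S => clippedGradAvg w κ S T.snd j) (Measure.pi fun _ : Fin n => D) :=
      (indepFun_clippedGradAvg T.disjoint).comp (hp i) (hp j)
    have h1 := hi _ (T.fst_nonempty hn)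
    have h2 := hi _ (T.snd_nonempty hn)
    have e (i j : Fin d) : ∫ S, clippedGradAvg w κ S T.fst i * clippedGradAvg w κ S T.snd j
        ∂(Measure.pi fun _ : Fin n => D) = g i * g j := by
      rw [(hind i j).integral_fun_mul_eq_mul_integral (h1 i).aestronglyMeasurable
        (h2 j).aestronglyMeasurable, integral_clippedGradAvg hR (T.fst_nonempty hn),
        integral_clippedGradAvg hR (T.snd_nonempty hn)]
    simp only [batchMatrix, symmOuter, Matrix.smul_apply, Matrix.add_apply, Matrix.vecMulVec_apply,
      smul_eq_mul]
    simp only [mul_comm (clippedGradAvg w κ _ T.snd i)]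
    have hm (i j : Fin d) : Integrable (fun S => clippedGradAvg w κ S T.fst i *
        clippedGradAvg w κ S T.snd j) (Measure.pi fun _ : Fin n => D) :=
      (hind i j).integrable_mul (h1 i) (h2 j)
    rw [integral_const_mul, integral_add (hm i j) (hm j i), e, e]
    ring
  simp [key]

/-- For a fixed division, independence factors `E ‖u‖² (v·x)²` into `E ‖u‖² ≤ d s` times `E (v·x)² ≤
s ‖x‖²`. -/
theorem integral_batchMatrix_sq_le (hn : 2 ≤ n) (hR : ∀ᵐ p ∂D, ‖clippedGrad w κ p‖ ≤ R)
    (h0 : 0 ≤ s)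
    (hs : ∀ x : Fin d → ℝ, ∫ p, ((clippedGrad w κ p).ofLp ⬝ᵥ x) ^ 2 ∂D ≤ s * (x ⬝ᵥ x))
    (x : Fin d → ℝ) :
    ∫ B, (batchMatrix w κ B *ᵥ x) ⬝ᵥ (batchMatrix w κ B *ᵥ x) ∂(batchLaw n D) ≤
      d * s ^ 2 * (x ⬝ᵥ x) := by
  have hx : 0 ≤ x ⬝ᵥ x := Finset.sum_nonneg fun i _ => mul_self_nonneg _
  have hFi := Matrix.integrable_mulVec_dotProduct_mulVec (measurable_batchMatrix w κ)
    (ae_norm_batchMatrix_le hn hR) x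
  rw [integral_batchLaw hFi]
  have hF2 := (integrable_prod_iff' hFi.1).1 hFi
  have key : ∀ᵐ T ∂(PMF.uniformOfFintype (Split n)).toMeasure,
      ∫ S, (batchMatrix w κ (S, T) *ᵥ x) ⬝ᵥ (batchMatrix w κ (S, T) *ᵥ x)
        ∂(Measure.pi fun _ : Fin n => D) ≤ d * s ^ 2 * (x ⬝ᵥ x) := by
    filter_upwards [hF2.1] with T hT
    have hm1 : Measurable fun y : EuclideanSpace ℝ (Fin d) => y.ofLp ⬝ᵥ y.ofLp := by
      simp only [dotProduct]; fun_prop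
    have hm2 : Measurable fun y : EuclideanSpace ℝ (Fin d) => (y.ofLp ⬝ᵥ x) ^ 2 := by
      simp only [dotProduct]; fun_prop
    have half (T₁ T₂ : Finset (Fin n)) (hT₁ : T₁.Nonempty) (hT₂ : T₂.Nonempty)
        (hd : Disjoint T₁ T₂) :
        Integrable (fun S => ((clippedGradAvg w κ S T₁).ofLp ⬝ᵥ (clippedGradAvg w κ S T₁).ofLp) *
          ((clippedGradAvg w κ S T₂).ofLp ⬝ᵥ x) ^ 2) (Measure.pi fun _ : Fin n => D) ∧
        ∫ S, ((clippedGradAvg w κ S T₁).ofLp ⬝ᵥ (clippedGradAvg w κ S T₁).ofLp) *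
          ((clippedGradAvg w κ S T₂).ofLp ⬝ᵥ x) ^ 2 ∂(Measure.pi fun _ : Fin n => D) ≤
          d * s ^ 2 * (x ⬝ᵥ x) := by
      have hb (T : Finset (Fin n)) (hT : T.Nonempty) :
          ∀ᵐ S ∂(Measure.pi fun _ : Fin n => D), ‖clippedGradAvg w κ S T‖ ≤ R :=
        (ae_pi_norm_clippedGrad_le hR).mono fun S h => norm_clippedGradAvg_le h hT
      have hind := (indepFun_clippedGradAvg (w := w) (κ := κ) (D := D) hd).comp hm1 hm2
      have i1 : Integrable (fun S => (clippedGradAvg w κ S T₁).ofLp ⬝ᵥ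
          (clippedGradAvg w κ S T₁).ofLp) (Measure.pi fun _ : Fin n => D) := by
        refine Integrable.of_bound (C := R ^ 2)
          (hm1.comp (measurable_clippedGradAvg w κ T₁)).aestronglyMeasurable
          ((hb T₁ hT₁).mono fun S h => ?_)
        rw [← norm_sq_eq_dotProduct, Real.norm_of_nonneg (sq_nonneg _)]
        gcongr
      have i2 := integrable_sq_dotProduct (measurable_clippedGradAvg w κ T₂) (hb T₂ hT₂) x
      refine ⟨hind.integrable_mul i1 i2, ?_⟩
      have hI := hind.integral_fun_mul_eq_mul_integral i1.aestronglyMeasurable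
        i2.aestronglyMeasurable
      simp only [Function.comp_def] at hI
      rw [hI]
      have l1 := integral_norm_sq_le (measurable_clippedGradAvg w κ T₁) (hb T₁ hT₁)
        (integral_sq_clippedGradAvg_dotProduct_le hR hs hT₁)
      have l2 := integral_sq_clippedGradAvg_dotProduct_le hR hs hT₂ x
      calc _ ≤ (d * s) * (s * (x ⬝ᵥ x)) :=
            mul_le_mul l1 l2 (integral_nonneg fun _ => sq_nonneg _) (by positivity)
        _ = _ := by ring
    obtain ⟨a1, a2⟩ := half _ _ (T.fst_nonempty hn) (T.snd_nonempty hn) T.disjoint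
    obtain ⟨b1, b2⟩ := half _ _ (T.snd_nonempty hn) (T.fst_nonempty hn) T.disjoint.symm
    refine (integral_mono hT ((a1.add b1).const_mul 2⁻¹) fun S =>
      symmOuter_mulVec_dotProduct_self_le _ _ x).trans ?_
    rw [integral_const_mul, integral_add' a1 b1]
    linarith
  refine (integral_mono_ae hFi.integral_prod_right (integrable_const _) key).trans (le_of_eq ?_)
  simp

/-- The centered contribution of a divided batch to the gradient matrix. -/
def centeredBatchMatrix (D : Measure (Sample d)) (w : EuclideanSpace ℝ (Fin d)) (κ : ℝ)
    (B : SplitBatch d n) : Matrix (Fin d) (Fin d) ℝ :=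
  batchMatrix w κ B - symmOuter (∫ p, clippedGrad w κ p ∂D) (∫ p, clippedGrad w κ p ∂D)

theorem symmOuter_self (g : EuclideanSpace ℝ (Fin d)) :
    symmOuter g g = Matrix.vecMulVec g.ofLp g.ofLp := by
  rw [symmOuter, ← two_smul ℝ, smul_smul]; norm_num

theorem measurable_centeredBatchMatrix (D : Measure (Sample d)) (w : EuclideanSpace ℝ (Fin d))
    (κ : ℝ) : Measurable (centeredBatchMatrix D w κ : SplitBatch d n → Matrix (Fin d) (Fin d) ℝ) :=
  (measurable_batchMatrix w κ).sub_const _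

theorem isSymm_centeredBatchMatrix (D : Measure (Sample d)) (B : SplitBatch d n) :
    (centeredBatchMatrix D w κ B).IsSymm :=
  (isSymm_symmOuter _ _).sub (isSymm_symmOuter _ _)

theorem ae_norm_centeredBatchMatrix_le (hn : 2 ≤ n) (hR : ∀ᵐ p ∂D, ‖clippedGrad w κ p‖ ≤ R) :
    ∀ᵐ B ∂(batchLaw n D), ‖centeredBatchMatrix D w κ B‖ ≤ 2 * R ^ 2 := by
  have hg : ‖∫ p, clippedGrad w κ p ∂D‖ ≤ R := by
    simpa using norm_integral_le_of_norm_le_const hR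
  filter_upwards [ae_norm_batchMatrix_le hn hR] with B h
  refine (norm_sub_le _ _).trans ?_
  have := norm_symmOuter_le (∫ p, clippedGrad w κ p ∂D) (∫ p, clippedGrad w κ p ∂D)
  nlinarith [norm_nonneg (∫ p, clippedGrad w κ p ∂D)]

theorem integral_centeredBatchMatrix (hn : 2 ≤ n) (hR : ∀ᵐ p ∂D, ‖clippedGrad w κ p‖ ≤ R)
    (i j : Fin d) : ∫ B, centeredBatchMatrix D w κ B i j ∂(batchLaw n D) = 0 := by
  simp only [centeredBatchMatrix, Matrix.sub_apply, symmOuter_self, Matrix.vecMulVec_apply]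
  rw [integral_sub (Matrix.integrable_entry (measurable_batchMatrix w κ)
    (ae_norm_batchMatrix_le hn hR) i j) (integrable_const _), integral_batchMatrix hn hR]
  simp

theorem integral_centeredBatchMatrix_sq_le (hn : 2 ≤ n)
    (hR : ∀ᵐ p ∂D, ‖clippedGrad w κ p‖ ≤ R) (h0 : 0 ≤ s)
    (hs : ∀ x : Fin d → ℝ, ∫ p, ((clippedGrad w κ p).ofLp ⬝ᵥ x) ^ 2 ∂D ≤ s * (x ⬝ᵥ x))
    (x : Fin d → ℝ) :
    ∫ B, (centeredBatchMatrix D w κ B *ᵥ x) ⬝ᵥ (centeredBatchMatrix D w κ B *ᵥ x)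
      ∂(batchLaw n D) ≤ d * s ^ 2 * (x ⬝ᵥ x) := by
  set g := ∫ p, clippedGrad w κ p ∂D
  set y := symmOuter g g *ᵥ x
  have hent := Matrix.integrable_entry (measurable_batchMatrix w κ) (ae_norm_batchMatrix_le hn hR)
  have i1 := Matrix.integrable_mulVec_dotProduct_mulVec (measurable_batchMatrix w κ)
    (ae_norm_batchMatrix_le hn hR) x
  have i2 := Matrix.integrable_dotProduct_mulVec hent y x
  -- Since `y` is the mean of `batchMatrix w κ B *ᵥ x`, integrating this expansion shows that
  -- centering lowers the second moment by `‖y‖²`.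
  have e (B : SplitBatch d n) :
      (centeredBatchMatrix D w κ B *ᵥ x) ⬝ᵥ (centeredBatchMatrix D w κ B *ᵥ x) =
      (batchMatrix w κ B *ᵥ x) ⬝ᵥ (batchMatrix w κ B *ᵥ x) -
        2 * (y ⬝ᵥ batchMatrix w κ B *ᵥ x) + y ⬝ᵥ y := by
    rw [centeredBatchMatrix, Matrix.sub_mulVec, sub_dotProduct, dotProduct_sub, dotProduct_sub,
      dotProduct_comm _ y]
    ring
  simp only [e]
  have i3 : Integrable (fun B => (batchMatrix w κ B *ᵥ x) ⬝ᵥ (batchMatrix w κ B *ᵥ x) -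
        2 * (y ⬝ᵥ batchMatrix w κ B *ᵥ x)) (batchLaw n D) := i1.sub (i2.const_mul 2)
  have hM : (Matrix.of fun i j => ∫ B, batchMatrix w κ B i j ∂(batchLaw n D)) =
      symmOuter g g := by
    ext i j
    rw [symmOuter_self, Matrix.of_apply, integral_batchMatrix hn hR]; rfl
  rw [integral_add i3 (integrable_const _), integral_sub i1 (i2.const_mul 2), integral_const_mul,
    Matrix.integral_dotProduct_mulVec hent, hM]
  have hy : 0 ≤ y ⬝ᵥ y := Finset.sum_nonneg fun i _ => mul_self_nonneg _
  have := integral_batchMatrix_sq_le hn hR h0 hs x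
  simp only [integral_const, probReal_univ, one_smul]
  linarith

end Batch

end GradSub

end

/-! ### Singular value decompositions and perturbation of the averaged outer product. -/

noncomputable section

namespace GradSub

open scoped Matrix.Norms.L2Operator RealInnerProductSpace

variable {d : ℕ}

theorem toEuclideanCLM_vecMulVec (a b x : EuclideanSpace ℝ (Fin d)) :
    Matrix.toEuclideanCLM (n := Fin d) (𝕜 := ℝ) (Matrix.vecMulVec a.ofLp b.ofLp) x =
      ⟪b, x⟫ • a := by
  ext i
  simp only [Matrix.ofLp_toEuclideanCLM, Matrix.vecMulVec_mulVec, PiLp.smul_apply, Pi.smul_apply,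
    EuclideanSpace.inner_eq_star_dotProduct, star_trivial, dotProduct_comm b.ofLp]
  simp [mul_comm]

theorem IsSVD.apply {A : Matrix (Fin d) (Fin d) ℝ} {σ : Fin d → ℝ}
    {u v : OrthonormalBasis (Fin d) ℝ (EuclideanSpace ℝ (Fin d))} (h : IsSVD A σ u v)
    (x : EuclideanSpace ℝ (Fin d)) :
    Matrix.toEuclideanCLM (n := Fin d) (𝕜 := ℝ) A x = ∑ i, (σ i * ⟪v i, x⟫) • u i := by
  rw [h.eq_sum, map_sum, _root_.sum_apply]
  refine Finset.sum_congr rfl fun i _ => ?_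
  rw [map_smul, _root_.smul_apply, toEuclideanCLM_vecMulVec, smul_smul]

theorem inner_le_opNorm_mul (A : Matrix (Fin d) (Fin d) ℝ) (x y : EuclideanSpace ℝ (Fin d)) :
    ⟪x, Matrix.toEuclideanCLM (n := Fin d) (𝕜 := ℝ) A y⟫ ≤ ‖A‖ * (‖x‖ * ‖y‖) := by
  refine (real_inner_le_norm _ _).trans ?_
  calc ‖x‖ * ‖Matrix.toEuclideanCLM (n := Fin d) (𝕜 := ℝ) A y‖ ≤ ‖x‖ * (‖A‖ * ‖y‖) := by
        gcongr
        exact (Matrix.toEuclideanCLM (n := Fin d) (𝕜 := ℝ) A).le_opNorm y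
    _ = _ := by ring

theorem sum_abs_inner_mul_abs_inner_le {ι : Type*} {E : Type*} [NormedAddCommGroup E]
    [InnerProductSpace ℝ E] [Fintype ι] (u v : OrthonormalBasis ι ℝ E) (s : Finset ι) (x : E) :
    ∑ i ∈ s, |⟪u i, x⟫| * |⟪v i, x⟫| ≤ ‖x‖ ^ 2 := by
  have key (w : OrthonormalBasis ι ℝ E) : ∑ i ∈ s, |⟪w i, x⟫| ^ 2 ≤ ‖x‖ ^ 2 := by
    rw [← w.sum_sq_norm_inner_right x]
    exact Finset.sum_le_sum_of_subset_of_nonneg (Finset.subset_univ s) fun i _ _ => sq_nonneg _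
  have : ∑ i ∈ s, |⟪u i, x⟫| * |⟪v i, x⟫| ≤
      ∑ i ∈ s, (|⟪u i, x⟫| ^ 2 + |⟪v i, x⟫| ^ 2) / 2 :=
    Finset.sum_le_sum fun i _ => by nlinarith [sq_nonneg (|⟪u i, x⟫| - |⟪v i, x⟫|)]
  rw [← Finset.sum_div, Finset.sum_add_distrib] at this
  linarith [key u, key v]

/-- Only the terms with `i ≥ L` survive, with `σ i ≤ σ L`. Left and right singular vectors may
differ, so the remaining products are bounded by AM-GM and Parseval. -/
theorem IsSVD.inner_apply_self_le {A : Matrix (Fin d) (Fin d) ℝ} {σ : Fin d → ℝ}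
    {u v : OrthonormalBasis (Fin d) ℝ (EuclideanSpace ℝ (Fin d))} (h : IsSVD A σ u v) (L : Fin d)
    {z : EuclideanSpace ℝ (Fin d)} (hz : ∀ i < L, ⟪u i, z⟫ = 0) :
    ⟪z, Matrix.toEuclideanCLM (n := Fin d) (𝕜 := ℝ) A z⟫ ≤ σ L * ‖z‖ ^ 2 := by
  rw [h.apply, inner_sum]
  refine le_trans ?_ (mul_le_mul_of_nonneg_left
    (sum_abs_inner_mul_abs_inner_le u v Finset.univ z) (h.nonneg L))
  rw [Finset.mul_sum]
  refine Finset.sum_le_sum fun i _ => ?_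
  rw [inner_smul_right, real_inner_comm (u i) z]
  rcases lt_or_ge i L with hi | hi
  · simp [hz i hi]
  · calc σ i * ⟪v i, z⟫ * ⟪u i, z⟫ ≤ |σ i * ⟪v i, z⟫ * ⟪u i, z⟫| := le_abs_self _
      _ = σ i * (|⟪u i, z⟫| * |⟪v i, z⟫|) := by
        rw [abs_mul, abs_mul, abs_of_nonneg (h.nonneg i)]; ring
      _ ≤ _ := mul_le_mul_of_nonneg_right (h.antitone hi) (by positivity)

/-- **Weyl's inequality** for a perturbation of a matrix of rank at most `L`. -/
theorem IsSVD.singularValue_le_of_rank {A M : Matrix (Fin d) (Fin d) ℝ} {σ : Fin d → ℝ}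
    {u v : OrthonormalBasis (Fin d) ℝ (EuclideanSpace ℝ (Fin d))} (h : IsSVD A σ u v) (L : Fin d)
    {k : ℕ} (hk : k ≤ L) (g : ℕ → EuclideanSpace ℝ (Fin d))
    (hM : ∀ x, (∀ i < k, ⟪g i, x⟫ = 0) → Matrix.toEuclideanCLM (n := Fin d) (𝕜 := ℝ) M x = 0) :
    σ L ≤ ‖A - M‖ := by
  -- `L + 1` coefficients against `k ≤ L` equations: some nonzero combination `y` of `v 0, …, v L`
  -- is orthogonal to the first `k` vectors `g i`. Pairing `A y` with `x`, the same combination of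
  -- the `u i`, recovers `∑ σ i * a i ^ 2`.
  let Φ : (Finset.Iic L → ℝ) →ₗ[ℝ] (Fin k → ℝ) :=
    LinearMap.pi fun j => ∑ i : Finset.Iic L, ⟪g j, v i⟫ • LinearMap.proj i
  have hker : LinearMap.ker Φ ≠ ⊥ := LinearMap.ker_ne_bot_of_finrank_lt (by
    rw [Module.finrank_fin_fun, Module.finrank_fintype_fun_eq_card, Fintype.card_coe, Fin.card_Iic]
    omega)
  obtain ⟨a, ha, ha0⟩ := (Submodule.ne_bot_iff _).1 hker
  have ha' (j : Fin k) : ∑ i : Finset.Iic L, ⟪g j, v i⟫ * a i = 0 := by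
    have := congrFun (LinearMap.mem_ker.1 ha) j
    simpa [Φ] using this
  set y := ∑ i : Finset.Iic L, a i • v i
  set x := ∑ i : Finset.Iic L, a i • u i
  have hn (w : OrthonormalBasis (Fin d) ℝ (EuclideanSpace ℝ (Fin d))) :
      ‖∑ i : Finset.Iic L, a i • w i‖ ^ 2 = ∑ i, a i ^ 2 := by
    have ho : Orthonormal ℝ fun i : Finset.Iic L => w i :=
      w.orthonormal.comp _ Subtype.val_injective
    rw [← real_inner_self_eq_norm_sq, ho.inner_sum]
    simp [sq]
  have hpos : 0 < ∑ i, a i ^ 2 := by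
    obtain ⟨i, hi⟩ := Function.ne_iff.1 ha0
    exact Finset.sum_pos' (fun _ _ => sq_nonneg _) ⟨i, Finset.mem_univ i, by
      have : a i ≠ 0 := hi
      positivity⟩
  have hMy : Matrix.toEuclideanCLM (n := Fin d) (𝕜 := ℝ) M y = 0 := by
    refine hM y fun j hj => ?_
    simp only [y, inner_sum, inner_smul_right]
    simpa [mul_comm] using ha' ⟨j, hj⟩
  have hAy : Matrix.toEuclideanCLM (n := Fin d) (𝕜 := ℝ) A y =
      ∑ i : Finset.Iic L, (a i * σ i) • u i := by
    simp only [y, map_sum, map_smul]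
    refine Finset.sum_congr rfl fun i _ => ?_
    rw [h.apply, mul_smul]
    congr 1
    rw [Finset.sum_eq_single i.1]
    · simp
    · intro j _ hj
      rw [v.inner_eq_zero hj]; simp
    · simp
  have hxA : ⟪x, Matrix.toEuclideanCLM (n := Fin d) (𝕜 := ℝ) A y⟫ =
      ∑ i : Finset.Iic L, σ i * a i ^ 2 := by
    have ho : Orthonormal ℝ fun i : Finset.Iic L => u i :=
      u.orthonormal.comp _ Subtype.val_injective
    rw [hAy, ho.inner_sum]
    refine Finset.sum_congr rfl fun i _ => ?_
    simp; ring
  have hle := inner_le_opNorm_mul (A - M) x y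
  rw [map_sub, _root_.sub_apply, hMy, sub_zero, hxA] at hle
  have hxy : ‖x‖ * ‖y‖ ≤ ∑ i, a i ^ 2 := by
    nlinarith [sq_nonneg (‖x‖ - ‖y‖), hn u, hn v]
  have hlow : σ L * ∑ i, a i ^ 2 ≤ ∑ i : Finset.Iic L, σ i * a i ^ 2 := by
    rw [Finset.mul_sum]
    exact Finset.sum_le_sum fun i _ => mul_le_mul_of_nonneg_right
      (h.antitone (Finset.mem_Iic.1 i.2)) (sq_nonneg _)
  exact le_of_mul_le_mul_right
    (hlow.trans (hle.trans (mul_le_mul_of_nonneg_left hxy (norm_nonneg _)))) hpos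

/-- The second-moment matrix of a finite collection of vectors. -/
def averageOuter {N : ℕ} (g : Fin N → EuclideanSpace ℝ (Fin d)) : Matrix (Fin d) (Fin d) ℝ :=
  (N : ℝ)⁻¹ • ∑ b, Matrix.vecMulVec (g b).ofLp (g b).ofLp

theorem toEuclideanCLM_averageOuter {N : ℕ} (g : Fin N → EuclideanSpace ℝ (Fin d))
    (x : EuclideanSpace ℝ (Fin d)) :
    Matrix.toEuclideanCLM (n := Fin d) (𝕜 := ℝ) (averageOuter g) x =
      (N : ℝ)⁻¹ • ∑ b, ⟪g b, x⟫ • g b := by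
  simp only [averageOuter, map_smul, map_sum, _root_.smul_apply,
    _root_.sum_apply, toEuclideanCLM_vecMulVec]

theorem inner_averageOuter {N : ℕ} (g : Fin N → EuclideanSpace ℝ (Fin d))
    (x y : EuclideanSpace ℝ (Fin d)) :
    ⟪x, Matrix.toEuclideanCLM (n := Fin d) (𝕜 := ℝ) (averageOuter g) y⟫ =
      (N : ℝ)⁻¹ * ∑ b, ⟪x, g b⟫ * ⟪y, g b⟫ := by
  rw [toEuclideanCLM_averageOuter, inner_smul_right, inner_sum]
  congr 1
  refine Finset.sum_congr rfl fun b _ => ?_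
  rw [inner_smul_right, real_inner_comm, mul_comm]

/-- A trace argument: `σ i = ⟨u i, A v i⟩`, and replacing `A` by the averaged outer product costs
the norm of the difference. Summed over `i ≤ L`, the remaining terms are at most the average of `‖g
b‖²`. -/
theorem IsSVD.mul_singularValue_le {A : Matrix (Fin d) (Fin d) ℝ} {σ : Fin d → ℝ}
    {u v : OrthonormalBasis (Fin d) ℝ (EuclideanSpace ℝ (Fin d))} (h : IsSVD A σ u v) (L : Fin d)
    {N : ℕ} {g : Fin N → EuclideanSpace ℝ (Fin d)} {s : ℝ} (hs : 0 ≤ s)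
    (hg : ∀ b, ‖g b‖ ^ 2 ≤ s) :
    (L + 1 : ℝ) * σ L ≤ (L + 1) * ‖A - averageOuter g‖ + s := by
  have hcard : ((Finset.Iic L).card : ℝ) = L + 1 := by simp
  have h1 (i : Fin d) : σ i ≤ ‖A - averageOuter g‖ +
      (N : ℝ)⁻¹ * ∑ b, |⟪u i, g b⟫| * |⟪v i, g b⟫| := by
    have hA : ⟪u i, Matrix.toEuclideanCLM (n := Fin d) (𝕜 := ℝ) A (v i)⟫ = σ i := by
      rw [h.apply, inner_sum, Finset.sum_eq_single i]
      · simp [inner_smul_right]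
      · intro j _ hj
        rw [v.inner_eq_zero hj]; simp
      · simp
    have hle := inner_le_opNorm_mul (A - averageOuter g) (u i) (v i)
    rw [map_sub, _root_.sub_apply, inner_sub_right, hA, inner_averageOuter,
      u.norm_eq_one, v.norm_eq_one, mul_one, mul_one] at hle
    have : (N : ℝ)⁻¹ * ∑ b, ⟪u i, g b⟫ * ⟪v i, g b⟫ ≤
        (N : ℝ)⁻¹ * ∑ b, |⟪u i, g b⟫| * |⟪v i, g b⟫| := by
      refine mul_le_mul_of_nonneg_left (Finset.sum_le_sum fun b _ => ?_) (by positivity)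
      rw [← abs_mul]; exact le_abs_self _
    linarith
  have h2 : (N : ℝ)⁻¹ * ∑ i ∈ Finset.Iic L, ∑ b, |⟪u i, g b⟫| * |⟪v i, g b⟫| ≤ s := by
    rw [Finset.sum_comm]
    have : ∑ b, ∑ i ∈ Finset.Iic L, |⟪u i, g b⟫| * |⟪v i, g b⟫| ≤ N * s := by
      refine (Finset.sum_le_sum fun b _ =>
        (sum_abs_inner_mul_abs_inner_le u v _ (g b)).trans (hg b)).trans (le_of_eq ?_)
      simp
    rcases N.eq_zero_or_pos with rfl | hN
    · simpa using hs
    · rw [inv_mul_le_iff₀ (by positivity)]; exact this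
  calc (L + 1 : ℝ) * σ L = ∑ i ∈ Finset.Iic L, σ L := by rw [Finset.sum_const, nsmul_eq_mul, hcard]
    _ ≤ ∑ i ∈ Finset.Iic L, (‖A - averageOuter g‖ +
          (N : ℝ)⁻¹ * ∑ b, |⟪u i, g b⟫| * |⟪v i, g b⟫|) :=
        Finset.sum_le_sum fun i hi => (h.antitone (Finset.mem_Iic.1 hi)).trans (h1 i)
    _ ≤ _ := by
        rw [Finset.sum_add_distrib, Finset.sum_const, nsmul_eq_mul, hcard, ← Finset.mul_sum]
        linarith

theorem inner_basis_apply_of_mul_transpose {P : Matrix (Fin d) (Fin d) ℝ} {ℓ : ℕ}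
    {U : Matrix (Fin d) (Fin (min ℓ d)) ℝ}
    {u : OrthonormalBasis (Fin d) ℝ (EuclideanSpace ℝ (Fin d))}
    (hU : ∀ i j, U i j = u (Fin.castLE (min_le_right ℓ d) j) i) (hP : P = U * U.transpose)
    (x : EuclideanSpace ℝ (Fin d)) (i : Fin d) :
    ⟪u i, Matrix.toEuclideanCLM (n := Fin d) (𝕜 := ℝ) (1 - P) x⟫ =
      if (i : ℕ) < ℓ then 0 else ⟪u i, x⟫ := by
  have hPx : Matrix.toEuclideanCLM (n := Fin d) (𝕜 := ℝ) P x =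
      ∑ j : Fin (min ℓ d), ⟪u (Fin.castLE (min_le_right ℓ d) j), x⟫ •
        u (Fin.castLE (min_le_right ℓ d) j) := by
    have : P = ∑ j : Fin (min ℓ d), Matrix.vecMulVec (u (Fin.castLE (min_le_right ℓ d) j)).ofLp
        (u (Fin.castLE (min_le_right ℓ d) j)).ofLp := by
      ext a b
      rw [hP, Matrix.mul_apply, Matrix.sum_apply]
      simp [Matrix.vecMulVec_apply, hU]
    rw [this, map_sum, _root_.sum_apply]
    simp only [toEuclideanCLM_vecMulVec]
  rw [map_sub, map_one, _root_.sub_apply, hPx, inner_sub_right, inner_sum]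
  simp only [inner_smul_right, one_apply_eq_self]
  split_ifs with hi
  · have hi' : (i : ℕ) < min ℓ d := lt_min hi i.2
    rw [Finset.sum_eq_single ⟨i, hi'⟩]
    · simp [show Fin.castLE (min_le_right ℓ d) ⟨i, hi'⟩ = i from rfl]
    · intro j _ hj
      rw [u.inner_eq_zero, mul_zero]
      rintro rfl
      exact hj rfl
    · simp
  · rw [Finset.sum_eq_zero, sub_zero]
    intro j _
    rw [u.inner_eq_zero, mul_zero]
    rintro rfl
    exact hi (j.2.trans_le (min_le_left _ _))

theorem residual_eq_zero {P : Matrix (Fin d) (Fin d) ℝ} {ℓ : ℕ}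
    {U : Matrix (Fin d) (Fin (min ℓ d)) ℝ}
    {u : OrthonormalBasis (Fin d) ℝ (EuclideanSpace ℝ (Fin d))}
    (hU : ∀ i j, U i j = u (Fin.castLE (min_le_right ℓ d) j) i) (hP : P = U * U.transpose)
    (hd : d ≤ ℓ) (x : EuclideanSpace ℝ (Fin d)) :
    Matrix.toEuclideanCLM (n := Fin d) (𝕜 := ℝ) (1 - P) x = 0 := by
  rw [← u.sum_repr' (Matrix.toEuclideanCLM (n := Fin d) (𝕜 := ℝ) (1 - P) x)]
  refine Finset.sum_eq_zero fun i _ => ?_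
  rw [inner_basis_apply_of_mul_transpose hU hP, if_pos (i.2.trans_le hd), zero_smul]

/-- The deterministic core. The quadratic form of the averaged outer product at the residual `z` is
at least `fraction c 0 * ‖z‖ ^ 4`, while that of `A` is at most `‖z‖²` times the first discarded
singular value. -/
theorem norm_sq_residual_le {A P : Matrix (Fin d) (Fin d) ℝ} {ℓ : ℕ}
    {U : Matrix (Fin d) (Fin (min ℓ d)) ℝ} (hU : IsTopSingularVectors A ℓ U)
    (hP : P = U * U.transpose) {N : ℕ} (c : Fin N → ℕ) (g : ℕ → EuclideanSpace ℝ (Fin d))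
    {s t τ : ℝ} (hs : 0 ≤ s) (hg : ∀ b, ‖g (c b)‖ ^ 2 ≤ s)
    (hA : ‖A - averageOuter fun b => g (c b)‖ ≤ t) (ht : 0 ≤ t) (hτ : 0 ≤ τ)
    (hℓ : (∀ b, c b < ℓ) ∨ s ≤ ℓ * τ) :
    fraction c 0 * ‖Matrix.toEuclideanCLM (n := Fin d) (𝕜 := ℝ) (1 - P) (g 0)‖ ^ 2 ≤
      τ + 2 * t := by
  obtain ⟨σ, u, v, hsvd, hU⟩ := hU
  set z := Matrix.toEuclideanCLM (n := Fin d) (𝕜 := ℝ) (1 - P) (g 0) with hzdef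
  have hz := inner_basis_apply_of_mul_transpose hU hP (g 0)
  rw [← hzdef] at hz
  have hzz : ⟪z, g 0⟫ = ‖z‖ ^ 2 := by
    rw [← real_inner_self_eq_norm_sq, ← u.sum_inner_mul_inner z (g 0),
      ← u.sum_inner_mul_inner z z]
    refine Finset.sum_congr rfl fun i _ => ?_
    rw [real_inner_comm (u i) z, hz]
    split_ifs <;> simp
  rcases eq_or_ne z 0 with h0 | h0
  · rw [h0]; simp; positivity
  have hℓd : ℓ < d := by
    by_contra! hd
    exact h0 (residual_eq_zero hU hP hd _)
  -- Indices start at `0`, so `σ L` is the singular value number `ℓ + 1`, the first discarded one.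
  set L : Fin d := ⟨ℓ, hℓd⟩
  have hσ : σ L ≤ τ + t := by
    rcases hℓ with h | h
    · refine (hsvd.singularValue_le_of_rank (M := averageOuter fun b => g (c b)) L (le_refl ℓ) g
        fun x hx => ?_).trans (hA.trans (by linarith))
      rw [toEuclideanCLM_averageOuter]
      simp [hx _ (h _)]
    · have := hsvd.mul_singularValue_le L hs hg
      have hL : ((L : ℕ) : ℝ) = ℓ := rfl
      rw [hL] at this
      have hp : (0 : ℝ) < ℓ + 1 := by positivity
      refine le_of_mul_le_mul_left (this.trans ?_) hp
      nlinarith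
  have h1 := hsvd.inner_apply_self_le L (z := z) fun i hi => by
    have hi' : (i : ℕ) < ℓ := hi
    rw [hz, if_pos hi']
  have h2 := inner_le_opNorm_mul (averageOuter (fun b => g (c b)) - A) z z
  rw [map_sub, _root_.sub_apply, inner_sub_right, inner_averageOuter, norm_sub_rev,
    ← sq] at h2
  have h3 : fraction c 0 * ‖z‖ ^ 2 * ‖z‖ ^ 2 ≤
      (N : ℝ)⁻¹ * ∑ b, ⟪z, g (c b)⟫ * ⟪z, g (c b)⟫ := by
    have : ∑ b ∈ Finset.univ.filter fun b => c b = 0, ⟪z, g (c b)⟫ * ⟪z, g (c b)⟫ ≤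
        ∑ b, ⟪z, g (c b)⟫ * ⟪z, g (c b)⟫ :=
      Finset.sum_le_sum_of_subset_of_nonneg (Finset.filter_subset _ _)
        fun b _ _ => mul_self_nonneg _
    rw [Finset.sum_congr rfl (g := fun _ => ‖z‖ ^ 2 * ‖z‖ ^ 2) fun b hb => by
      rw [(Finset.mem_filter.1 hb).2, hzz], Finset.sum_const, nsmul_eq_mul] at this
    refine le_trans (le_of_eq ?_) (mul_le_mul_of_nonneg_left this (by positivity))
    rw [fraction, div_eq_inv_mul]; ring
  have hzp : 0 < ‖z‖ ^ 2 := by positivity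
  refine le_of_mul_le_mul_right (h3.trans ?_) hzp
  nlinarith [mul_le_mul_of_nonneg_right hσ hzp.le, mul_le_mul_of_nonneg_right hA hzp.le]

end GradSub

end

/-! ### Concentration of the gradient matrix and choice of the Bernstein parameter. -/

noncomputable section

namespace GradSub

open ProbabilityTheory
open scoped Matrix Matrix.Norms.L2Operator

variable {d : ℕ}

theorem gradMatrix_sub_averageOuter {N : ℕ} {n : Fin N → ℕ} (D : ℕ → Measure (Sample d))
    (c : Fin N → ℕ) (w : EuclideanSpace ℝ (Fin d)) (κ : ℝ) (B : ∀ b, SplitBatch d (n b)) :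
    gradMatrix w κ B - averageOuter (fun b => ∫ p, clippedGrad w κ p ∂(D (c b))) =
      (N : ℝ)⁻¹ • ∑ b, centeredBatchMatrix (D (c b)) w κ (B b) := by
  have e : gradMatrix w κ B = (N : ℝ)⁻¹ • ∑ b, batchMatrix w κ (B b) := by
    simp only [gradMatrix, batchMatrix, symmOuter, ← Finset.smul_sum, smul_smul]
    rw [one_div, mul_inv, mul_comm]
  rw [e, averageOuter, ← smul_sub, ← Finset.sum_sub_distrib]
  simp only [centeredBatchMatrix, symmOuter_self]

theorem measureReal_lt_norm_gradMatrix_sub_le [Nonempty (Fin d)] {N : ℕ} (hN : 0 < N)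
    {n : Fin N → ℕ} (hn : ∀ b, 2 ≤ n b) (D : ℕ → Measure (Sample d))
    [∀ i, IsProbabilityMeasure (D i)] (c : Fin N → ℕ) (w : EuclideanSpace ℝ (Fin d)) {κ R s : ℝ}
    (hR : ∀ b, ∀ᵐ p ∂(D (c b)), ‖clippedGrad w κ p‖ ≤ R) (h0 : 0 ≤ s)
    (hs : ∀ b, ∀ x : Fin d → ℝ,
      ∫ p, ((clippedGrad w κ p).ofLp ⬝ᵥ x) ^ 2 ∂(D (c b)) ≤ s * (x ⬝ᵥ x))
    {θ : ℝ} (hθ : 0 ≤ θ) (hθR : θ * (2 * R ^ 2) ≤ 1) (t : ℝ) :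
    MeasurableSet {B : ∀ b, SplitBatch d (n b) | ‖gradMatrix w κ B -
      averageOuter (fun b => ∫ p, clippedGrad w κ p ∂(D (c b)))‖ ≤ t} ∧
    1 - 2 * d * Real.exp (N * (θ ^ 2 * (d * s ^ 2) - θ * t)) ≤
      (batchesLaw D c n).real {B | ‖gradMatrix w κ B -
        averageOuter (fun b => ∫ p, clippedGrad w κ p ∂(D (c b)))‖ ≤ t} := by
  have hN' : (0 : ℝ) < N := by exact_mod_cast hN
  let X : ∀ b, (∀ b, SplitBatch d (n b)) → Matrix (Fin d) (Fin d) ℝ :=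
    fun b B => centeredBatchMatrix (D (c b)) w κ (B b)
  have hX0 (b : Fin N) := measurable_centeredBatchMatrix (n := n b) (D (c b)) w κ
  have hX (b : Fin N) : Measurable (X b) := (hX0 b).comp (measurable_pi_apply b)
  have hind : iIndepFun X (batchesLaw D c n) := iIndepFun_pi fun b => (hX0 b).aemeasurable
  have hb (b : Fin N) : ∀ᵐ B ∂(batchesLaw D c n), ‖X b B‖ ≤ 2 * R ^ 2 :=
    (measurePreserving_eval (fun b => batchLaw (n b) (D (c b))) b).quasiMeasurePreserving.ae
      (ae_norm_centeredBatchMatrix_le (hn b) (hR b))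
  have hmean (b : Fin N) (i j : Fin d) : ∫ B, X b B i j ∂(batchesLaw D c n) = 0 :=
    (integral_pi_eval (fun b => batchLaw (n b) (D (c b))) b
      ((Matrix.measurable_entry i j).comp (hX0 b))).trans
      (integral_centeredBatchMatrix (hn b) (hR b) i j)
  have hm2 (x : Fin d → ℝ) : Measurable fun M : Matrix (Fin d) (Fin d) ℝ =>
      (M *ᵥ x) ⬝ᵥ (M *ᵥ x) :=
    Continuous.measurable (by fun_prop)
  have hvar (b : Fin N) (x : Fin d → ℝ) :
      ∫ B, (X b B *ᵥ x) ⬝ᵥ (X b B *ᵥ x) ∂(batchesLaw D c n) ≤ d * s ^ 2 * (x ⬝ᵥ x) :=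
    (integral_pi_eval (fun b => batchLaw (n b) (D (c b))) b ((hm2 x).comp (hX0 b))).trans_le
      (integral_centeredBatchMatrix_sq_le (hn b) (hR b) h0 (hs b) x)
  have hBern := Matrix.measureReal_le_norm_sum_le hX hind
    (fun b B => isSymm_centeredBatchMatrix _ _) hb hmean (by positivity) hvar hθ hθR (N * t)
  rw [Fintype.card_fin, Fintype.card_fin] at hBern
  set G : Set (∀ b, SplitBatch d (n b)) := {B | ‖gradMatrix w κ B -
      averageOuter (fun b => ∫ p, clippedGrad w κ p ∂(D (c b)))‖ ≤ t}
  have hGeq : G = {B | ‖∑ b, X b B‖ ≤ N * t} := by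
    ext B
    simp only [G, Set.mem_ofPred_eq]
    rw [gradMatrix_sub_averageOuter, norm_smul, norm_inv, Real.norm_natCast,
      inv_mul_le_iff₀ hN']
  have hGm : MeasurableSet G := by
    rw [hGeq]
    have hsum : Measurable fun B => ∑ b, X b B := Finset.measurable_sum _ fun b _ => hX b
    exact measurableSet_le (continuous_norm.measurable.comp hsum) measurable_const
  refine ⟨hGm, ?_⟩
  have hc : (batchesLaw D c n).real Gᶜ ≤
      (batchesLaw D c n).real {B | N * t ≤ ‖∑ b, X b B‖} := by
    refine measureReal_mono fun B hB => ?_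
    rw [hGeq] at hB
    exact (le_of_not_ge fun h => hB h : (N : ℝ) * t ≤ ‖∑ b, X b B‖)
  rw [probReal_compl_eq_one_sub hGm] at hc
  have e : N * (θ ^ 2 * (d * s ^ 2)) - θ * (N * t) = N * (θ ^ 2 * (d * s ^ 2) - θ * t) := by ring
  rw [e] at hBern
  linarith

theorem exists_exponent_bound {d N a s q r δ : ℝ} (hd : 2 ≤ d) (ha : 0 < a) (hs : 0 < s)
    (hq : 0 < q) (hr : r = q * s * d) (hδ : 0 < δ) (hδ1 : δ < 1)
    (hN : 8 * (d / a * (1 / a + q) * Real.log (d / δ)) ≤ N) :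
    ∃ θ, 0 ≤ θ ∧ θ * (2 * r) ≤ 1 ∧
      2 * d * Real.exp (N * (θ ^ 2 * (d * s ^ 2) - θ * (a * s))) ≤ δ := by
  have hd0 : 0 < d := by linarith
  have hlog : 0 ≤ Real.log (d / δ) := Real.log_nonneg (by rw [le_div_iff₀ hδ]; linarith)
  set Λ := Real.log (d / δ)
  have hr0 : 0 < r := by rw [hr]; positivity
  have hN0 : 0 ≤ N := le_trans (by positivity) hN
  -- The second value minimizes `θ² d s² - θ a s`; the first is the largest that Bernstein admits.
  -- The first case uses the `q` term of the sample size, the second the `1 / a` term.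
  set θ := min (1 / (2 * r)) (a / (2 * d * s))
  have hθ0 : 0 < θ := lt_min (by positivity) (by positivity)
  have h1 : θ * (2 * r) ≤ 1 := by
    rw [← le_div_iff₀ (by positivity)]; exact min_le_left _ _
  have h2 : θ * (d * s ^ 2) ≤ a * s / 2 := by
    have : θ ≤ a / (2 * d * s) := min_le_right _ _
    rw [le_div_iff₀ (by positivity)] at this
    nlinarith
  -- Twice the logarithm is required so that `(δ / d)²` absorbs the prefactor `2 * d`, using `d ≥ 2`
  -- and `δ < 1`.
  have h3 : 2 * Λ ≤ N * (θ * (a * s) / 2) := by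
    rcases min_choice (1 / (2 * r)) (a / (2 * d * s)) with h | h
    · have e : θ * (a * s) / 2 = a / (4 * q * d) := by
        simp only [θ]; rw [h, hr]; field_simp; norm_num
      rw [e]
      calc 2 * Λ = 8 * (d / a * q * Λ) * (a / (4 * q * d)) := by field_simp; ring
        _ ≤ 8 * (d / a * (1 / a + q) * Λ) * (a / (4 * q * d)) := by
          gcongr
          have : 0 < 1 / a := by positivity
          linarith
        _ ≤ _ := by gcongr
    · have e : θ * (a * s) / 2 = a ^ 2 / (4 * d) := by
        simp only [θ]; rw [h]; field_simp; norm_num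
      rw [e]
      calc 2 * Λ = 8 * (d / a * (1 / a) * Λ) * (a ^ 2 / (4 * d)) := by field_simp; ring
        _ ≤ 8 * (d / a * (1 / a + q) * Λ) * (a ^ 2 / (4 * d)) := by
          gcongr
          linarith
        _ ≤ _ := by gcongr
  refine ⟨θ, hθ0.le, h1, ?_⟩
  have h4 : N * (θ ^ 2 * (d * s ^ 2) - θ * (a * s)) ≤ -(2 * Λ) := by
    have : θ ^ 2 * (d * s ^ 2) - θ * (a * s) ≤ -(θ * (a * s) / 2) := by nlinarith
    nlinarith [mul_le_mul_of_nonneg_left this hN0]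
  have h5 : Real.exp (-(2 * Λ)) = (δ / d) ^ 2 := by
    rw [Real.exp_neg, two_mul, Real.exp_add, Real.exp_log (by positivity)]
    field_simp
  calc 2 * d * Real.exp (N * (θ ^ 2 * (d * s ^ 2) - θ * (a * s))) ≤ 2 * d * (δ / d) ^ 2 := by
        rw [← h5]; gcongr
    _ = δ * (2 * δ / d) := by field_simp
    _ ≤ δ * 1 := by
        gcongr
        rw [div_le_one hd0]; linarith
    _ = δ := mul_one δ

end GradSub

end

/-! ### Assembly of the main theorem. -/

theorem mainTheorem5 :
    ∃ K : ℝ, 0 < K ∧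
      ∀ (d : ℕ) (k : ℕ∞) (D : ℕ → Measure (GradSub.Sample d)) [∀ i, IsProbabilityMeasure (D i)]
        (C₁ C₂ : ℝ), 0 < C₁ → 0 < C₂ →
        (∀ i : ℕ, (i : ℕ∞) < k → GradSub.spectralNorm (GradSub.secondMoment (D i)) ≤ C₁) →
        (∀ i : ℕ, (i : ℕ∞) < k → ∀ᵐ p ∂(D i), ‖p.1‖ ≤ C₂ * √(d : ℝ)) →
      ∀ (w : EuclideanSpace ℝ (Fin d)) (κ α ε δ : ℝ), 0 < κ → 0 < α → 0 < ε → 0 < δ →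
      ∀ (N : ℕ) (n : Fin N → ℕ) (c : Fin N → ℕ) (ℓ : ℕ),
        (∀ b, 2 ≤ n b) → (∀ b, (c b : ℕ∞) < k) →
        K * (d / (α * ε ^ 2) * (1 / (α * ε ^ 2) + C₂ ^ 2 / C₁) * Real.log (d / δ)) ≤ (N : ℝ) →
        α / 2 ≤ GradSub.fraction c 0 →
        min (k : ℝ≥0∞) (ENNReal.ofReal (1 / (2 * α * ε ^ 2))) ≤ (ℓ : ℝ≥0∞) →
        ∃ G : Set (∀ b, GradSub.SplitBatch d (n b)), MeasurableSet G ∧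
          1 - δ ≤ (GradSub.batchesLaw D c n).real G ∧
          ∀ B ∈ G, ∀ P : Matrix (Fin d) (Fin d) ℝ, GradSub.IsGradSubEst B κ w ℓ P →
            ‖Matrix.toEuclideanCLM (n := Fin d) (𝕜 := ℝ) (1 - P)
                (∫ p, GradSub.clippedGrad w κ p ∂(D 0))‖ ≤ 4 * ε * κ * √C₁ := by
  refine ⟨8, by norm_num, ?_⟩
  intro d k D _ C₁ C₂ hC₁ hC₂ hcov hbd w κ α ε δ hκ hα hε hδ N n c ℓ hn hck hN hfrac hℓ
  rcases le_or_gt 1 δ with hδ1 | hδ1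
  · exact ⟨∅, MeasurableSet.empty, by simpa using hδ1, fun B hB => absurd hB (by simp)⟩
  -- For `N = 0` the fraction is `0 / 0 = 0`, against `α / 2 > 0`.
  have hN0 : 0 < N := by
    rcases N.eq_zero_or_pos with rfl | h
    · simp [GradSub.fraction] at hfrac; linarith
    · exact h
  have hk0 : k ≠ 0 := fun h => not_lt_bot (h ▸ hck ⟨0, hN0⟩)
  have ha : 0 < α * ε ^ 2 := by positivity
  have hℓ0 : 1 ≤ ℓ := by
    by_contra! h
    obtain rfl : ℓ = 0 := by omega
    rw [Nat.cast_zero] at hℓ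
    rcases min_le_iff.1 hℓ with h | h
    · exact hk0 (by simpa using h)
    · have : 0 < 1 / (2 * α * ε ^ 2) := by positivity
      exact (ENNReal.ofReal_pos.2 this).not_ge h
  rcases le_or_gt d 1 with hd | hd
  -- In dimension at most one, `ℓ ≥ 1` makes the projection the identity; the exponent bound needs
  -- `d ≥ 2`.
  · refine ⟨Set.univ, MeasurableSet.univ, by simp [hδ.le], ?_⟩
    rintro B - P ⟨U, ⟨σ, u, v, -, hU⟩, hP⟩
    rw [GradSub.residual_eq_zero hU hP (hd.trans hℓ0), norm_zero]
    positivity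
  have : Nonempty (Fin d) := ⟨⟨0, by omega⟩⟩
  set s := κ ^ 2 * C₁ with hs_def
  have hs0 : 0 < s := by positivity
  have hR (b : Fin N) := GradSub.ae_norm_clippedGrad_le (hbd _ (hck b)) w hκ
  have hs (b : Fin N) := GradSub.integral_sq_clippedGrad_dotProduct_le
    (hcov _ (hck b)) (hbd _ (hck b)) w hκ
  obtain ⟨θ, hθ, hθR, hθδ⟩ := GradSub.exists_exponent_bound (d := d) (N := N) (a := α * ε ^ 2)
    (s := s) (q := C₂ ^ 2 / C₁) (r := (κ * (C₂ * √(d : ℝ))) ^ 2) (δ := δ)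
    (by exact_mod_cast hd) ha hs0 (by positivity) (by
      rw [mul_pow, mul_pow, Real.sq_sqrt (Nat.cast_nonneg d), hs_def]; field_simp) hδ hδ1 hN
  obtain ⟨hGm, hG⟩ := GradSub.measureReal_lt_norm_gradMatrix_sub_le hN0 hn D c w hR hs0.le hs hθ
    hθR (α * ε ^ 2 * s)
  refine ⟨_, hGm, by linarith, ?_⟩
  rintro B hB P ⟨U, hU, hP⟩
  have hg (b : Fin N) : ‖∫ p, GradSub.clippedGrad w κ p ∂(D (c b))‖ ^ 2 ≤ s :=
    GradSub.norm_sq_integral_le (GradSub.measurable_clippedGrad w κ) (hR b) hs0.le (hs b)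
  -- The two terms of the minimum bounding `ℓ` correspond to the rank case and the trace case.
  have hcase : (∀ b, c b < ℓ) ∨ s ≤ ℓ * (2 * (α * ε ^ 2) * s) := by
    rcases min_le_iff.1 hℓ with h | h
    · left
      intro b
      have hk : k ≤ (ℓ : ℕ∞) := by
        rw [← ENat.toENNReal_le]; simpa using h
      exact_mod_cast (hck b).trans_le hk
    · right
      have h' : 1 / (2 * α * ε ^ 2) ≤ (ℓ : ℝ) := ENNReal.ofReal_le_natCast.1 h
      rw [div_le_iff₀ (by positivity)] at h'
      nlinarith
  have hres := GradSub.norm_sq_residual_le hU hP c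
    (fun i => ∫ p, GradSub.clippedGrad w κ p ∂(D i)) hs0.le hg hB (by positivity)
    (τ := 2 * (α * ε ^ 2) * s) (by positivity) hcase
  refine abs_le_of_sq_le_sq' ?_ (by positivity) |>.2
  set z := ‖Matrix.toEuclideanCLM (n := Fin d) (𝕜 := ℝ) (1 - P)
    (∫ p, GradSub.clippedGrad w κ p ∂(D 0))‖
  have h1 : α / 2 * z ^ 2 ≤ α / 2 * (8 * ε ^ 2 * s) :=
    (mul_le_mul_of_nonneg_right hfrac (sq_nonneg z)).trans (hres.trans (le_of_eq (by ring)))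
  have h2 := le_of_mul_le_mul_left h1 (by positivity)
  have h3 : (4 * ε * κ * √C₁) ^ 2 = 16 * ε ^ 2 * s := by
    rw [mul_pow, Real.sq_sqrt hC₁.le, hs_def]; ring
  rw [h3]
  nlinarith [mul_pos (pow_pos hε 2) hs0]
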